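/- Setting. Let $M$ be a compact metrizable space and $\Gamma\subset\mathsf{Homeo}(M)$ a subgroup which is a (discrete) convergence group: every sequence of distinct elements of $\Gamma$ has a subsequence $\{\gamma_{n_j}\}$ such that, for some $x,y\in M$, $\gamma_{n_j}|_{M\smallsetminus\{y\}}$ converges locally uniformly to $x$. The limit set $\Lambda(\Gamma)$ is the set of $x\in M$ for which there are $y\in M$ and a sequence $\{\gamma_n\}\subset\Gamma$ with $\gamma_n|_{M\smallsetminus\{y\}}\to x$ locally uniformly. Assume that $\Gamma$ is non-elementary, i.e. $\#\Lambda(\Gamma)\ge 3$. The conical limit set $\Lambda^{\rm con}(\Gamma)$ is the set of $x\in\Lambda(\Gamma)$ for which there are distinct $a,b\in M$ and $\{\gamma_n\}\subset\Gamma$ with $\gamma_n x\to a$ and $\gamma_n y\to b$ for all $y\in M\smallsetminus\{x\}$. Let $\mathrm d$ be a compatible metric on $\Gamma\sqcup M$, i.e. a metric inducing a compact topology for which the inclusions of $\Gamma$ (discrete) and of $M$ are embeddings and the natural action of $\Gamma$ on $\Gamma\sqcup M$ (left multiplication on $\Gamma$) is by homeomorphisms and has the convergence property above, with $\Gamma \sqcup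 M$ in place of $M$. For $\epsilon>0$, the $\epsilon$-uniform conical limit set $\Lambda^{\rm con}_\epsilon(\Gamma)$ is the set of $x\in M$ for which there are $a,b\in M$ and $\{\gamma_n\}\subset\Gamma$ with $\mathrm d(a,b)\ge\epsilon$, $\gamma_n x\to b$, and $\gamma_n y\to a$ for all $y\in M\smallsetminus\{x\}$. Let $\sigma\colon\Gamma\times M\to\mathbb R$ be a coarse-cocycle: for some $\kappa$, $\limsup_{x\to x_0}|\sigma(\gamma,x_0)-\sigma(\gamma,x)|\le\kappa$ and $|\sigma(\gamma_1\gamma_2,x)-\sigma(\gamma_1,\gamma_2x)-\sigma(\gamma_2,x)|\le\kappa$ for all $\gamma,\gamma_1,\gamma_2\in\Gamma$ and $x_0,x\in M$. Assume that $\sigma$ is expanding, i.e. (a) $\sigma(\gamma_n,\gamma_n^+)\to+\infty$ for every sequence of distinct loxodromic $\gamma_n\in\Gamma$ with $\liminf_n\mathrm d(\gamma_n^-,\gamma_n^+)>0$. Here $\gamma$ is loxodromic if it has two distinct fixed points $\gamma^+,\gamma^-$ such that $\gamma^{\pm n}|_{M\smallsetminus\{\gamma^\mp\}}\to\gamma^\pm$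 locally uniformly as $n\to\infty$; (b) there are numbers $\|\gamma\|_\sigma\in\mathbb R$ ($\gamma\in\Gamma$) such that for every $\epsilon>0$ there is $c>0$ with $\|\gamma\|_\sigma-c\le\sigma(\gamma,x)\le\|\gamma\|_\sigma+c$ whenever $x\in M$, $\gamma\in\Gamma$ and $\mathrm d(x,\gamma^{-1})>\epsilon$. Fix such numbers. A $C$-coarse $\sigma$-Patterson--Sullivan measure of dimension $\delta$ is a Borel probability measure $\mu$ on $M$ such that for every $\gamma\in\Gamma$ the measures $\mu$ and $\gamma_*\mu$ are mutually absolutely continuous and $e^{-C-\delta\sigma(\gamma^{-1},\cdot)}\le\frac{d\gamma_*\mu}{d\mu}\le e^{C-\delta\sigma(\gamma^{-1},\cdot)}$ $\mu$-almost everywhere. Theorem. Suppose that $\delta:=\inf\{s>0:\sum_{\gamma\in\Gamma}e^{-s\|\gamma\|_\sigma}<+\infty\}$ is finite and that $\sum_{\gamma\in\Gamma}e^{-\delta\|\gamma\|_\sigma}=+\infty$. Let $\mu$ be a $C$-coarse $\sigma$-Patterson--Sullivan measure of dimension $\delta$. Then: 1. $\Gamma$ acts ergodically on $(M,\mu)$: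 every Borel set $A \subset M$ with $\mu(\gamma^{-1}A\,\triangle\,A)=0$ for all $\gamma\in\Gamma$ satisfies $\mu(A)=0$ or $\mu(M\smallsetminus A)=0$. 2. If $\lambda$ is any $C$-coarse $\sigma$-Patterson--Sullivan measure of dimension $\delta$, then $e^{-4C}\mu\le\lambda\le e^{4C}\mu$. 3. $\Lambda^{\rm con}(\Gamma)$ has full $\mu$-measure. Moreover, there is $\epsilon_0>0$ such that $\Lambda^{\rm con}_\epsilon(\Gamma)$ has full $\mu$-measure for every $0<\epsilon\le\epsilon_0$. -/

import Mathlib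

open Set Filter Topology MeasureTheory
open scoped ENNReal NNReal

namespace ConvGroup

/-! ## Convergence groups -/

/-- The sequence of maps `f n : X → X` converges locally uniformly on `U` to the constant `a`.
The limit being constant, no uniform structure on `X` is needed; the next lemma identifies this
with Mathlib's `TendstoLocallyUniformlyOn` for every uniform structure inducing the topology. -/
def ConvLocUnif {X : Type*} [TopologicalSpace X] (f : ℕ → X → X) (U : Set X) (a : X) : Prop :=
  ∀ V ∈ 𝓝 a, ∀ z ∈ U, ∃ W ∈ 𝓝[U] z, ∀ᶠ n in atTop, ∀ w ∈ W, f n w ∈ V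

theorem convLocUnif_iff {X : Type*} [UniformSpace X] (f : ℕ → X → X) (U : Set X) (a : X) :
    ConvLocUnif f U a ↔ TendstoLocallyUniformlyOn f (fun _ => a) atTop U := by
  constructor
  · intro h u hu x hx
    exact h _ (UniformSpace.ball_mem_nhds a hu) x hx
  · intro h V hV x hx
    obtain ⟨u, hu, huV⟩ := UniformSpace.mem_nhds_iff.1 hV
    obtain ⟨t, ht, h'⟩ := h u hu x hx
    exact ⟨t, ht, h'.mono fun n hn y hy => huV (hn y hy)⟩

/-- The convergence property of a family of maps `act g : X → X`, `g ∈ G`: every sequence of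
distinct elements has a subsequence which, for some `a b : X`, converges to `a` locally uniformly
on `X ∖ {b}`. -/
def HasConvergenceProperty {G X : Type*} [TopologicalSpace X] (act : G → X → X) : Prop :=
  ∀ γ : ℕ → G, Function.Injective γ → ∃ (a b : X) (φ : ℕ → ℕ), StrictMono φ ∧
    ConvLocUnif (fun n => act (γ (φ n))) {b}ᶜ a

variable {M : Type*} [TopologicalSpace M]

/-- `Γ ⊆ Homeo(M)` is a (discrete) convergence group. -/
def IsConvergenceGroup (Γ : Subgroup (M ≃ₜ M)) : Prop :=
  HasConvergenceProperty (fun (γ : Γ) (x : M) => (γ : M ≃ₜ M) x)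

/-- The limit set of `Γ`. -/
def limitSet (Γ : Subgroup (M ≃ₜ M)) : Set M :=
  {x | ∃ (y : M) (γ : ℕ → Γ), ConvLocUnif (fun n z => (γ n : M ≃ₜ M) z) {y}ᶜ x}

/-- `Γ` is non-elementary: its limit set has at least three points. -/
def IsNonElementary (Γ : Subgroup (M ≃ₜ M)) : Prop :=
  3 ≤ (limitSet Γ).encard

/-- The conical limit set of `Γ`. -/
def conicalLimitSet (Γ : Subgroup (M ≃ₜ M)) : Set M :=
  {x | x ∈ limitSet Γ ∧ ∃ (a b : M) (γ : ℕ → Γ), a ≠ b ∧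
    Tendsto (fun n => (γ n : M ≃ₜ M) x) atTop (𝓝 a) ∧
    ∀ y, y ≠ x → Tendsto (fun n => (γ n : M ≃ₜ M) y) atTop (𝓝 b)}

/-- `g` is loxodromic with attracting fixed point `p` and repelling fixed point `q`. (Both points
then lie in the limit set of any group containing `g`.) -/
def IsLoxodromic (g : M ≃ₜ M) (p q : M) : Prop :=
  p ≠ q ∧ g p = p ∧ g q = q ∧
    ConvLocUnif (fun n z => (g ^ n) z) {q}ᶜ p ∧
    ConvLocUnif (fun n z => (g⁻¹ ^ n) z) {p}ᶜ q

/-! ## The compactification `Γ ⊔ M` -/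

/-- The set `Γ ⊔ M`. No topology is built in. -/
inductive Bord (Γ : Subgroup (M ≃ₜ M)) : Type _
  | elt (γ : Γ) : Bord Γ
  | pt (x : M) : Bord Γ

/-- The natural action of `Γ` on `Γ ⊔ M`: left multiplication on `Γ`, the given action on `M`. -/
def Bord.act (Γ : Subgroup (M ≃ₜ M)) (γ : Γ) : Bord Γ → Bord Γ
  | .elt g => .elt (γ * g)
  | .pt x => .pt ((γ : M ≃ₜ M) x)

/-- The given topology on `Γ ⊔ M` is a compactifying topology. -/
structure IsCompactifying (Γ : Subgroup (M ≃ₜ M)) [TopologicalSpace (Bord Γ)] : Prop where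
  compact : CompactSpace (Bord Γ)
  metrizable : TopologicalSpace.MetrizableSpace (Bord Γ)
  /-- `Γ`, with the discrete topology, embeds. -/
  embedding_elt : @IsEmbedding Γ (Bord Γ) ⊥ _ Bord.elt
  embedding_pt : IsEmbedding (Bord.pt : M → Bord Γ)
  continuous_act : ∀ γ : Γ, Continuous (Bord.act Γ γ)
  convergence : HasConvergenceProperty (Bord.act Γ)

/-- The `ε`-uniform conical limit set of `Γ`, with respect to a metric on `Γ ⊔ M`. -/
def uniformConicalLimitSet (Γ : Subgroup (M ≃ₜ M)) [MetricSpace (Bord Γ)] (ε : ℝ) : Set M :=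
  {x | ∃ (a b : M) (γ : ℕ → Γ), ε ≤ dist (Bord.pt a : Bord Γ) (Bord.pt b) ∧
    Tendsto (fun n => (γ n : M ≃ₜ M) x) atTop (𝓝 b) ∧
    ∀ y, y ≠ x → Tendsto (fun n => (γ n : M ≃ₜ M) y) atTop (𝓝 a)}

/-! ## Coarse-cocycles -/

/-- `σ : Γ × M → ℝ` is a `κ`-coarse-cocycle. The first field says
`limsup_{x → x₀} |σ(γ, x₀) - σ(γ, x)| ≤ κ`. -/
structure IsCoarseCocycle (Γ : Subgroup (M ≃ₜ M)) (κ : ℝ) (σ : Γ → M → ℝ) : Prop where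
  coarsely_continuous : ∀ (γ : Γ) (x₀ : M), ∀ ε > 0, ∀ᶠ x in 𝓝 x₀, |σ γ x₀ - σ γ x| ≤ κ + ε
  coarse_cocycle : ∀ (γ₁ γ₂ : Γ) (x : M),
    |σ (γ₁ * γ₂) x - (σ γ₁ ((γ₂ : M ≃ₜ M) x) + σ γ₂ x)| ≤ κ

/-- `σ` is proper: `σ(γₙ, γₙ⁺) → +∞` for all sequences of distinct loxodromic elements with
`liminf d(γₙ⁻, γₙ⁺) > 0`. -/
def IsProperCocycle (Γ : Subgroup (M ≃ₜ M)) [MetricSpace (Bord Γ)] (σ : Γ → M → ℝ) : Prop :=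
  ∀ (γ : ℕ → Γ) (p q : ℕ → M), Function.Injective γ →
    (∀ n, IsLoxodromic (γ n : M ≃ₜ M) (p n) (q n)) →
    (∃ ε > 0, ∀ᶠ n in atTop, ε ≤ dist (Bord.pt (q n) : Bord Γ) (Bord.pt (p n))) →
    Tendsto (fun n => σ (γ n) (p n)) atTop atTop

/-- `N : Γ → ℝ` is a choice of `σ`-magnitudes. -/
def IsMagnitude (Γ : Subgroup (M ≃ₜ M)) [MetricSpace (Bord Γ)] (σ : Γ → M → ℝ)
    (N : Γ → ℝ) : Prop :=
  ∀ ε > 0, ∃ C > 0, ∀ (x : M) (γ : Γ), ε < dist (Bord.pt x : Bord Γ) (Bord.elt γ⁻¹) →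
    N γ - C ≤ σ γ x ∧ σ γ x ≤ N γ + C

/-- `σ` is expanding. -/
def IsExpanding (Γ : Subgroup (M ≃ₜ M)) [MetricSpace (Bord Γ)] (σ : Γ → M → ℝ) : Prop :=
  IsProperCocycle Γ σ ∧ ∃ N : Γ → ℝ, IsMagnitude Γ σ N

/-- The Poincaré series `∑_γ exp (-s ‖γ‖) ∈ [0, ∞]`. -/
noncomputable def poincareSeries {Γ : Subgroup (M ≃ₜ M)} (N : Γ → ℝ) (s : ℝ) : ℝ≥0∞ :=
  ∑' γ : Γ, ENNReal.ofReal (Real.exp (-s * N γ))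

/-- The critical exponent `inf {s > 0 | Q(s) < ∞} ∈ [0, ∞]` (with `inf ∅ = ∞`). -/
noncomputable def criticalExponent {Γ : Subgroup (M ≃ₜ M)} (N : Γ → ℝ) : ℝ≥0∞ :=
  sInf (ENNReal.ofReal '' {s : ℝ | 0 < s ∧ poincareSeries N s < ∞})

/-! ## Patterson–Sullivan measures and ergodicity -/

variable [MeasurableSpace M] [BorelSpace M]

/-- `μ` is a `C`-coarse `σ`-Patterson–Sullivan measure of dimension `δ`. -/
structure IsPattersonSullivan (Γ : Subgroup (M ≃ₜ M)) (σ : Γ → M → ℝ) (C δ : ℝ)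
    (μ : Measure M) : Prop where
  isProbability : IsProbabilityMeasure μ
  map_ac : ∀ γ : Γ, μ.map (γ : M ≃ₜ M) ≪ μ
  ac_map : ∀ γ : Γ, μ ≪ μ.map (γ : M ≃ₜ M)
  rnDeriv_bounds : ∀ γ : Γ, ∀ᵐ x ∂μ,
    ENNReal.ofReal (Real.exp (-C - δ * σ γ⁻¹ x)) ≤ (μ.map (γ : M ≃ₜ M)).rnDeriv μ x ∧
    (μ.map (γ : M ≃ₜ M)).rnDeriv μ x ≤ ENNReal.ofReal (Real.exp (C - δ * σ γ⁻¹ x))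

/-- `Γ` acts ergodically on `(M, μ)`: Borel sets that are `Γ`-invariant modulo null sets are null
or co-null. (Mathlib's `ErgodicSMul` also requires `μ` to be `Γ`-invariant.) -/
def ActsErgodically (Γ : Subgroup (M ≃ₜ M)) (μ : Measure M) : Prop :=
  ∀ A : Set M, MeasurableSet A → (∀ γ : Γ, (γ : M ≃ₜ M) ⁻¹' A =ᵐ[μ] A) →
    μ A = 0 ∨ μ Aᶜ = 0

end ConvGroup

open ConvGroup

namespace ConvGroup

/-! ### Convergence dynamics on the compactification `Bord Γ`. -/

section

/-! The argument studies shadows: `shadow ε γ` is the image under `γ` of the points of `M` at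
distance at least `ε` from `γ⁻¹`. On those points `σ γ` is `N γ` up to a constant, and for small `ε`
they carry a uniform amount of mass because no point of `M` is fixed by all of `Γ`. So shadows have
measure comparable to `exp (-δ * N γ)`. Properness makes `N` tend to infinity along `Γ`. This yields
the geometric facts behind the covering arguments: when two shadows meet, the one with essentially
larger magnitude lies in an enlargement of the other (`exists_shadow_subset_shadow`), and the
relative position of the two group elements is controlled (`exists_le_dist_of_mem_shadow`).

Divergence enters once, in `exists_measure_limsupShadow_ne_zero`. If almost every point lay in only
finitely many shadows, suitable large pieces of shadows would overlap boundedly often, and the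
Poincaré series would be bounded by a multiple of the total mass. Applied to restrictions to
invariant sets, this shows that almost every orbit meets a limsup of shadows, whose points are
conical.

Shadows shrink around such points, so a Vitali covering compares any two coarsely conformal measures
and makes them mutually absolutely continuous (`absolutelyContinuous`). Applied to the restrictions
of one measure to an invariant set and to its complement, this is ergodicity. Ergodicity then bounds
the density between two Patterson–Sullivan measures, and upgrades positive mass of one limsup of
shadows to full mass of its saturation, which gives a single `ε₀`. -/

theorem convLocUnif_compl_singleton_iff {X : Type*} [TopologicalSpace X] [T1Space X]
    {f : ℕ → X → X} {a b : X} :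
    ConvLocUnif f {b}ᶜ a ↔
      ∀ z ≠ b, Tendsto (fun p : ℕ × X => f p.1 p.2) (atTop ×ˢ 𝓝 z) (𝓝 a) := by
  constructor
  · intro h z hz V hV
    obtain ⟨W, hW, hn⟩ := h V hV z hz
    rw [isOpen_compl_singleton.nhdsWithin_eq hz] at hW
    exact mem_prod_iff.2 ⟨_, hn, W, hW, fun p hp => hp.1 p.2 hp.2⟩
  · intro h V hV z hz
    obtain ⟨s, hs, W, hW, hsub⟩ := mem_prod_iff.1 (h z hz hV)
    exact ⟨W, mem_nhdsWithin_of_mem_nhds hW, mem_of_superset hs fun n hn w hw =>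
      hsub (Set.mk_mem_prod hn hw)⟩

theorem ConvLocUnif.tendsto {X : Type*} [TopologicalSpace X] [T1Space X]
    {f : ℕ → X → X} {a b : X} (h : ConvLocUnif f {b}ᶜ a) {z : ℕ → X} {w : X}
    (hz : Tendsto z atTop (𝓝 w)) (hw : w ≠ b) :
    Tendsto (fun n => f n (z n)) atTop (𝓝 a) :=
  (convLocUnif_compl_singleton_iff.1 h w hw).comp (tendsto_id.prodMk hz)

theorem ConvLocUnif.subseq {X : Type*} [TopologicalSpace X]
    {f : ℕ → X → X} {U : Set X} {a : X} (h : ConvLocUnif f U a) {φ : ℕ → ℕ}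
    (hφ : Tendsto φ atTop atTop) : ConvLocUnif (fun n => f (φ n)) U a := by
  intro V hV z hz
  obtain ⟨W, hW, hn⟩ := h V hV z hz
  exact ⟨W, hW, hφ.eventually hn⟩

theorem ConvLocUnif.eventually_mapsTo {X : Type*} [TopologicalSpace X] [T1Space X]
    {f : ℕ → X → X} {a b : X} (h : ConvLocUnif f {b}ᶜ a) {K V : Set X} (hK : IsCompact K)
    (hb : b ∉ K) (hV : V ∈ 𝓝 a) : ∀ᶠ n in atTop, MapsTo (f n) K V := by
  have key : {p : ℕ × X | f p.1 p.2 ∈ V} ∈ (atTop : Filter ℕ) ×ˢ 𝓝ˢ K :=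
    hK.mem_prod_nhdsSet_of_forall fun z hz =>
      convLocUnif_compl_singleton_iff.1 h z (fun e => hb (e ▸ hz)) hV
  obtain ⟨s, hs, W, hW, hsub⟩ := mem_prod_iff.1 key
  exact mem_of_superset hs fun n hn w hw =>
    hsub (Set.mk_mem_prod hn (subset_of_mem_nhdsSet hW hw))

/-- First countability makes the joint limit in index and point sequential, so the sub-subsequence
criterion applies. -/
theorem convLocUnif_of_subseq {X : Type*} [TopologicalSpace X] [T1Space X]
    [FirstCountableTopology X] {f : ℕ → X → X} {a b : X}
    (h : ∀ φ : ℕ → ℕ, StrictMono φ → ∃ ψ : ℕ → ℕ, StrictMono ψ ∧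
      ConvLocUnif (fun n => f (φ (ψ n))) {b}ᶜ a) : ConvLocUnif f {b}ᶜ a := by
  refine convLocUnif_compl_singleton_iff.2 fun z hz => tendsto_of_subseq_tendsto fun ns hns => ?_
  obtain ⟨φ, hφ, hφ'⟩ := strictMono_subseq_of_tendsto_atTop (tendsto_fst.comp hns)
  obtain ⟨ψ, hψ, hc⟩ := h _ hφ'
  refine ⟨fun n => φ (ψ n), ?_⟩
  exact hc.tendsto (z := fun n => (ns (φ (ψ n))).2)
    ((tendsto_snd.comp hns).comp (hφ.tendsto_atTop.comp hψ.tendsto_atTop)) hz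

variable {M : Type*} [TopologicalSpace M] {Γ : Subgroup (M ≃ₜ M)}

theorem Bord.act_mul (g h : Γ) (z : Bord Γ) :
    Bord.act Γ (g * h) z = Bord.act Γ g (Bord.act Γ h z) := by
  cases z with
  | elt k => exact congrArg Bord.elt (mul_assoc g h k)
  | pt x => rfl

theorem Bord.act_one (z : Bord Γ) : Bord.act Γ 1 z = z := by
  cases z with
  | elt k => exact congrArg Bord.elt (one_mul k)
  | pt x => rfl

theorem Bord.act_inv_act (g : Γ) (z : Bord Γ) : Bord.act Γ g⁻¹ (Bord.act Γ g z) = z := by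
  rw [← Bord.act_mul, inv_mul_cancel, Bord.act_one]

theorem Bord.act_act_inv (g : Γ) (z : Bord Γ) : Bord.act Γ g (Bord.act Γ g⁻¹ z) = z := by
  rw [← Bord.act_mul, mul_inv_cancel, Bord.act_one]

theorem Bord.act_injective (g : Γ) : Function.Injective (Bord.act Γ g) :=
  Function.LeftInverse.injective (Bord.act_inv_act g)

theorem Bord.pt_injective : Function.Injective (Bord.pt : M → Bord Γ) :=
  fun _ _ h => by injection h

theorem Bord.elt_injective : Function.Injective (Bord.elt : Γ → Bord Γ) :=
  fun _ _ h => by injection h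

variable [MetricSpace (Bord Γ)]

theorem IsCompactifying.isClosed_range_pt [CompactSpace M] (hd : IsCompactifying Γ) :
    IsClosed (range (Bord.pt : M → Bord Γ)) :=
  (isCompact_range hd.embedding_pt.continuous).isClosed

/-- Discreteness isolates `g` only within `Γ`; it is isolated in the whole space because the compact
set `M` is closed. -/
theorem IsCompactifying.isOpen_singleton_elt [CompactSpace M] (hd : IsCompactifying Γ) (g : Γ) :
    IsOpen {(Bord.elt g : Bord Γ)} := by
  let : TopologicalSpace Γ := ⊥
  obtain ⟨V, hV, hVg⟩ := hd.embedding_elt.isInducing.isOpen_iff.1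
    (show IsOpen ({g} : Set Γ) from trivial)
  have : {(Bord.elt g : Bord Γ)} = V ∩ (range Bord.pt)ᶜ := by
    ext z
    cases z with
    | elt k =>
      have : k ∈ Bord.elt ⁻¹' V ↔ k ∈ ({g} : Set Γ) := by rw [hVg]
      simpa [Bord.elt_injective.eq_iff] using this.symm
    | pt x => simp
  rw [this]
  exact hV.inter hd.isClosed_range_pt.isOpen_compl

theorem IsCompactifying.countable (hd : IsCompactifying Γ) : Countable Γ := by
  have := hd.compact
  let : TopologicalSpace Γ := ⊥
  have : DiscreteTopology Γ := ⟨rfl⟩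
  have : SecondCountableTopology Γ := hd.embedding_elt.secondCountableTopology
  exact TopologicalSpace.separableSpace_iff_countable.1 inferInstance

theorem exists_subseq_const_or_injective {G : Type*} [Countable G] (f : ℕ → G) :
    ∃ φ : ℕ → ℕ, StrictMono φ ∧
      ((∃ g, ∀ n, f (φ n) = g) ∨ Function.Injective fun n => f (φ n)) := by
  by_cases h : ∃ g, ∃ᶠ n in atTop, f n = g
  · obtain ⟨g, hg⟩ := h
    obtain ⟨φ, hφ, h⟩ := extraction_of_frequently_atTop hg
    exact ⟨φ, hφ, Or.inl ⟨g, h⟩⟩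
  · push Not at h
    obtain ⟨e, he⟩ := exists_injective_nat G
    have h1 : Tendsto f atTop cofinite := by
      refine (hasBasis_cofinite.tendsto_right_iff).2 fun s hs => ?_
      have := (Filter.eventually_all_finite hs).2 fun g _ => h g
      filter_upwards [this] with n hn hmem using hn _ hmem rfl
    have h2 : Tendsto (e ∘ f) atTop atTop := by
      rw [← Nat.cofinite_eq_atTop]
      rw [← Nat.cofinite_eq_atTop] at h1
      exact he.tendsto_cofinite.comp h1
    obtain ⟨φ, hφ, hφ'⟩ := strictMono_subseq_of_tendsto_atTop h2
    exact ⟨φ, hφ, Or.inr fun m n hmn => hφ'.injective (congrArg e hmn)⟩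

/-- The elements `γ n` converge to `pt a` locally uniformly off `pt b` on `Γ ⊔ M`, and their
inverses converge to `pt b` locally uniformly off `pt a`. -/
structure ConvergesTo (γ : ℕ → Γ) (a b : M) : Prop where
  fwd : ConvLocUnif (fun n => Bord.act Γ (γ n)) {Bord.pt b}ᶜ (Bord.pt a)
  bwd : ConvLocUnif (fun n => Bord.act Γ (γ n)⁻¹) {Bord.pt a}ᶜ (Bord.pt b)

namespace ConvergesTo

variable {γ : ℕ → Γ} {a b : M}

theorem inv (h : ConvergesTo γ a b) : ConvergesTo (fun n => (γ n)⁻¹) b a :=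
  ⟨h.bwd, by simpa using h.fwd⟩

theorem subseq (h : ConvergesTo γ a b) {φ : ℕ → ℕ} (hφ : StrictMono φ) :
    ConvergesTo (fun n => γ (φ n)) a b :=
  ⟨h.fwd.subseq hφ.tendsto_atTop, h.bwd.subseq hφ.tendsto_atTop⟩

theorem tendsto (h : ConvergesTo γ a b) {z : ℕ → Bord Γ} {w : Bord Γ}
    (hz : Tendsto z atTop (𝓝 w)) (hw : w ≠ Bord.pt b) :
    Tendsto (fun n => Bord.act Γ (γ n) (z n)) atTop (𝓝 (Bord.pt a)) :=
  h.fwd.tendsto hz hw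

theorem tendsto_elt (h : ConvergesTo γ a b) :
    Tendsto (fun n => (Bord.elt (γ n) : Bord Γ)) atTop (𝓝 (Bord.pt a)) := by
  have := h.tendsto (tendsto_const_nhds (x := (Bord.elt 1 : Bord Γ))) (by simp)
  simpa [Bord.act] using this

theorem tendsto_pt (hd : IsCompactifying Γ) (h : ConvergesTo γ a b) {x : M} (hx : x ≠ b) :
    Tendsto (fun n => (γ n : M ≃ₜ M) x) atTop (𝓝 a) :=
  hd.embedding_pt.tendsto_nhds_iff.2
    (h.tendsto (tendsto_const_nhds (x := (Bord.pt x : Bord Γ))) (by simpa using hx))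

theorem convLocUnif [T1Space M] (hd : IsCompactifying Γ) (h : ConvergesTo γ a b) :
    ConvLocUnif (fun n x => (γ n : M ≃ₜ M) x) {b}ᶜ a := by
  refine convLocUnif_compl_singleton_iff.2 fun z hz => hd.embedding_pt.tendsto_nhds_iff.2 ?_
  have := convLocUnif_compl_singleton_iff.1 h.fwd (Bord.pt z) (by simpa using hz)
  exact this.comp (tendsto_id.prodMap hd.embedding_pt.continuous.continuousAt)

end ConvergesTo

/-- The convergence property is applied to `f` and then to the inverses. Composing the two gives the
identity, which would become constant at a generic point unless the attracting point of each
sequence is the repelling point of the other. Both points lie in `M`, since distinct translates of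
an element of `Γ` cannot converge to an isolated point. -/
theorem IsCompactifying.exists_convergesTo [CompactSpace M] (hd : IsCompactifying Γ) {f : ℕ → Γ}
    (hf : Function.Injective f) :
    ∃ (φ : ℕ → ℕ) (a b : M), StrictMono φ ∧ ConvergesTo (fun n => f (φ n)) a b := by
  classical
  have : Infinite (Bord Γ) := Infinite.of_injective _ (Bord.elt_injective.comp hf)
  obtain ⟨A, B, φ, hφ, h1⟩ := hd.convergence f hf
  obtain ⟨A', B', ψ, hψ, h2⟩ := hd.convergence (fun n => (f (φ n))⁻¹)
    (inv_injective.comp (hf.comp hφ.injective))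
  replace h1 := h1.subseq hψ.tendsto_atTop
  have hB' : B' = A := by
    by_contra hne
    obtain ⟨z, hz⟩ := Infinite.exists_notMem_finset ({B, A'} : Finset (Bord Γ))
    simp only [Finset.mem_insert, Finset.mem_singleton, not_or] at hz
    have := h2.tendsto (h1.tendsto (tendsto_const_nhds (x := z)) hz.1) (Ne.symm hne)
    simp only [Bord.act_inv_act] at this
    exact hz.2 (tendsto_nhds_unique tendsto_const_nhds this)
  have hA' : B = A' := by
    by_contra hne
    obtain ⟨z, hz⟩ := Infinite.exists_notMem_finset ({B', A} : Finset (Bord Γ))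
    simp only [Finset.mem_insert, Finset.mem_singleton, not_or] at hz
    have := h1.tendsto (h2.tendsto (tendsto_const_nhds (x := z)) hz.1) (Ne.symm hne)
    simp only [Bord.act_act_inv] at this
    exact hz.2 (tendsto_nhds_unique tendsto_const_nhds this)
  subst hB' hA'
  have aux : ∀ (A B : Bord Γ) (g : ℕ → Γ), Function.Injective g →
      ConvLocUnif (fun n => Bord.act Γ (g n)) {B}ᶜ A → ∃ a, A = Bord.pt a := by
    intro A B g hg h
    obtain ⟨k, hk⟩ : ∃ k : Γ, (Bord.elt k : Bord Γ) ≠ B := by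
      by_contra! hall
      exact zero_ne_one (hg (Bord.elt_injective ((hall (g 0)).trans (hall (g 1)).symm)))
    have hk := h.tendsto (tendsto_const_nhds (x := (Bord.elt k : Bord Γ))) hk
    cases A with
    | pt a => exact ⟨a, rfl⟩
    | elt l =>
      have := hk.eventually ((hd.isOpen_singleton_elt l).mem_nhds rfl)
      obtain ⟨n, hn⟩ := (this.and ((tendsto_add_atTop_nat 1).eventually this)).exists
      have e := hn.1.trans hn.2.symm
      simp only [Bord.act] at e
      have := hg (mul_right_cancel (Bord.elt_injective e))
      omega
  have hi : Function.Injective fun n => f (φ (ψ n)) := hf.comp (hφ.comp hψ).injective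
  obtain ⟨a, rfl⟩ := aux _ _ _ hi h1
  obtain ⟨b, rfl⟩ := aux _ _ _ (inv_injective.comp hi) h2
  exact ⟨_, a, b, hφ.comp hψ, h1, h2⟩

theorem IsCompactifying.exists_subseq [CompactSpace M] (hd : IsCompactifying Γ) (f : ℕ → Γ) :
    ∃ φ : ℕ → ℕ, StrictMono φ ∧
      ((∃ g, ∀ n, f (φ n) = g) ∨ ∃ a b, ConvergesTo (fun n => f (φ n)) a b) := by
  have := hd.countable
  obtain ⟨φ, hφ, h | h⟩ := exists_subseq_const_or_injective f
  · exact ⟨φ, hφ, Or.inl h⟩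
  · obtain ⟨ψ, a, b, hψ, h'⟩ := hd.exists_convergesTo h
    exact ⟨_, hφ.comp hψ, Or.inr ⟨a, b, h'⟩⟩

end

/-! ### Loxodromic elements and the absence of a global fixed point. -/

section

variable {M : Type*} [TopologicalSpace M] {Γ : Subgroup (M ≃ₜ M)}

theorem IsNonElementary.exists_mem_limitSet_ne (hne : IsNonElementary Γ) (x y : M) :
    ∃ z ∈ limitSet Γ, z ≠ x ∧ z ≠ y := by
  by_contra! h
  have hsub : limitSet Γ ⊆ {x, y} := fun z hz => by
    by_cases hx : z = x
    · exact Or.inl hx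
    · exact Or.inr (h z hz hx)
  have h1 : (3 : ℕ∞) ≤ ({x, y} : Set M).encard := le_trans hne (encard_le_encard hsub)
  have h2 := h1.trans (encard_insert_le _ _)
  rw [encard_singleton] at h2
  exact absurd h2 (by norm_num)

theorem IsLoxodromic.inv {g : M ≃ₜ M} {p q : M} (h : IsLoxodromic g p q) :
    IsLoxodromic g⁻¹ q p := by
  obtain ⟨hpq, hp, hq, h1, h2⟩ := h
  refine ⟨hpq.symm, ?_, ?_, h2, by simpa using h1⟩
  · exact g.symm_apply_eq.2 hq.symm
  · exact g.symm_apply_eq.2 hp.symm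

theorem IsLoxodromic.tendsto [T1Space M] {g : M ≃ₜ M} {p q : M} (h : IsLoxodromic g p q) {x : M}
    (hx : x ≠ q) : Tendsto (fun n : ℕ => (g ^ n) x) atTop (𝓝 p) :=
  h.2.2.2.1.tendsto (tendsto_const_nhds (x := x)) hx

variable [CompactSpace M] [TopologicalSpace.MetrizableSpace M] [MetricSpace (Bord Γ)]

/-- A sequence witnessing a limit point might repeat elements, but a constant subsequence would
collapse two points of `M` to one. -/
theorem IsCompactifying.exists_convergesTo_of_mem_limitSet (hd : IsCompactifying Γ)
    (hne : IsNonElementary Γ) {x : M} (hx : x ∈ limitSet Γ) :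
    ∃ (γ : ℕ → Γ) (b : M), ConvergesTo γ x b := by
  obtain ⟨y, γ, h⟩ := hx
  obtain ⟨φ, hφ, ⟨g, hg⟩ | ⟨a, b, hab⟩⟩ := hd.exists_subseq γ
  · obtain ⟨u, -, huy, -⟩ := hne.exists_mem_limitSet_ne y y
    obtain ⟨v, -, hvy, hvu⟩ := hne.exists_mem_limitSet_ne y u
    have key : ∀ w ≠ y, (g : M ≃ₜ M) w = x := fun w hw => by
      have := (h.subseq hφ.tendsto_atTop).tendsto (tendsto_const_nhds (x := w)) hw
      simp only [hg] at this
      exact tendsto_nhds_unique tendsto_const_nhds this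
    exact absurd ((g : M ≃ₜ M).injective ((key v hvy).trans (key u huy).symm)) hvu
  · obtain ⟨u, -, huy, hub⟩ := hne.exists_mem_limitSet_ne y b
    have h1 := (h.subseq hφ.tendsto_atTop).tendsto (tendsto_const_nhds (x := u)) huy
    obtain rfl := tendsto_nhds_unique h1 (hab.tendsto_pt hd hub)
    exact ⟨_, b, hab⟩

/-- Powers of `g` send the complement of `B` into `A`, so every subsequential limit pair of the
powers lies in `A × B`. One such pair is fixed by `g`, since `g` commutes with its powers; being
fixed, it equals every other pair, so the whole sequence of powers converges. The point `c` outside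
both sets forces infinite order. -/
theorem IsCompactifying.exists_isLoxodromic_of_pingPong (hd : IsCompactifying Γ) (g : Γ)
    {A B : Set M} (hA : IsClosed A) (hB : IsClosed B) (hAB : Disjoint A B) {c : M} (hcA : c ∉ A)
    (hcB : c ∉ B) (hgA : ∀ x ∉ B, (g : M ≃ₜ M) x ∈ A)
    (hgB : ∀ x ∉ A, ((g⁻¹ : Γ) : M ≃ₜ M) x ∈ B) :
    ∃ p ∈ A, ∃ q ∈ B, IsLoxodromic (g : M ≃ₜ M) p q := by
  have hpA : ∀ (k : ℕ) (x : M), x ∉ B → ((g ^ (k + 1) : Γ) : M ≃ₜ M) x ∈ A := by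
    intro k
    induction k with
    | zero => simpa using hgA
    | succ k ih =>
      intro x hx
      rw [pow_succ']
      exact hgA _ (disjoint_left.1 hAB (ih x hx))
  have hpB : ∀ (k : ℕ) (x : M), x ∉ A → (((g ^ (k + 1))⁻¹ : Γ) : M ≃ₜ M) x ∈ B := by
    intro k
    induction k with
    | zero => simpa using hgB
    | succ k ih =>
      intro x hx
      rw [pow_succ, mul_inv_rev]
      exact hgB _ (disjoint_right.1 hAB (ih x hx))
  have hinj : Function.Injective fun k : ℕ => g ^ k := by
    rw [injective_pow_iff_not_isOfFinOrder, isOfFinOrder_iff_pow_eq_one]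
    rintro ⟨n, hn, h1⟩
    obtain ⟨k, rfl⟩ := Nat.exists_eq_succ_of_ne_zero hn.ne'
    have := hpA k c hcB
    rw [h1] at this
    exact hcA this
  have key : ∀ φ : ℕ → ℕ, StrictMono φ → ∃ (ψ : ℕ → ℕ) (p q : M), StrictMono ψ ∧ p ∈ A ∧ q ∈ B ∧
      ConvergesTo (fun n => g ^ φ (ψ n)) p q := by
    intro φ hφ
    obtain ⟨ψ, p, q, hψ, h⟩ := hd.exists_convergesTo (hinj.comp hφ.injective)
    have hpos : ∀ᶠ n in atTop, ∃ k, φ (ψ n) = k + 1 := by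
      filter_upwards [(hφ.comp hψ).tendsto_atTop.eventually (eventually_ge_atTop 1)] with n hn
      exact ⟨φ (ψ n) - 1, (Nat.sub_add_cancel hn).symm⟩
    refine ⟨ψ, p, q, hψ, ?_, ?_, h⟩
    -- It is not yet known that `q ∈ B`, so `c` itself may be `q`; then `g c` serves as the test
    -- point.
    · obtain ⟨x, hxB, hxq⟩ : ∃ x ∉ B, x ≠ q := by
        by_cases hc : c = q
        · refine ⟨(g : M ≃ₜ M) c, disjoint_left.1 hAB (hgA c hcB), fun e => hcA ?_⟩
          rw [hc, ← e]; exact hgA c hcB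
        · exact ⟨c, hcB, hc⟩
      refine hA.mem_of_tendsto (h.tendsto_pt hd hxq) ?_
      filter_upwards [hpos] with n ⟨k, hk⟩
      simpa only [Function.comp, hk] using hpA k x hxB
    · obtain ⟨x, hxA, hxp⟩ : ∃ x ∉ A, x ≠ p := by
        by_cases hc : c = p
        · refine ⟨((g⁻¹ : Γ) : M ≃ₜ M) c, disjoint_right.1 hAB (hgB c hcA), fun e => hcB ?_⟩
          rw [hc, ← e]; exact hgB c hcA
        · exact ⟨c, hcA, hc⟩
      refine hB.mem_of_tendsto (h.inv.tendsto_pt hd hxp) ?_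
      filter_upwards [hpos] with n ⟨k, hk⟩
      simpa only [Function.comp, hk] using hpB k x hxA
  obtain ⟨ψ, p, q, hψ, hp, hq, h⟩ := key id strictMono_id
  have hpq : p ≠ q := fun e => disjoint_left.1 hAB hp (e ▸ hq)
  have hgp : (g : M ≃ₜ M) p = p := by
    have h1 := h.tendsto_pt hd (x := (g : M ≃ₜ M) c)
      fun e => disjoint_left.1 hAB (hgA c hcB) (e ▸ hq)
    have h2 := ((g : M ≃ₜ M).continuous.tendsto p).comp
      (h.tendsto_pt hd (x := c) fun e => hcB (e ▸ hq))
    refine tendsto_nhds_unique h2 (h1.congr fun n => ?_)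
    exact congrArg (fun k : Γ => (k : M ≃ₜ M) c) ((Commute.refl g).pow_left _).eq
  have hgq : (g : M ≃ₜ M) q = q := by
    have h1 := h.inv.tendsto_pt hd (x := (g : M ≃ₜ M) c)
      fun e => hcA ((g : M ≃ₜ M).injective (e.trans hgp.symm) ▸ hp)
    have h2 := ((g : M ≃ₜ M).continuous.tendsto q).comp
      (h.inv.tendsto_pt hd (x := c) fun e => hcA (e ▸ hp))
    refine tendsto_nhds_unique h2 (h1.congr fun n => ?_)
    exact congrArg (fun k : Γ => (k : M ≃ₜ M) c) ((Commute.refl g).pow_left _).inv_left.eq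
  have hfixp : ∀ k : ℕ, ((g ^ k : Γ) : M ≃ₜ M) p = p := fun k => by
    induction k with
    | zero => rfl
    | succ k ih => rw [pow_succ]; exact (congrArg _ hgp).trans ih
  have hfixq : ∀ k : ℕ, ((g ^ k : Γ) : M ≃ₜ M) q = q := fun k => by
    induction k with
    | zero => rfl
    | succ k ih => rw [pow_succ]; exact (congrArg _ hgq).trans ih
  have key' : ∀ φ : ℕ → ℕ, StrictMono φ → ∃ ψ : ℕ → ℕ, StrictMono ψ ∧
      ConvergesTo (fun n => g ^ φ (ψ n)) p q := by
    intro φ hφ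
    obtain ⟨ψ, p', q', hψ, hp', hq', h⟩ := key φ hφ
    have e1 := h.tendsto_pt hd (x := p) fun e => disjoint_left.1 hAB hp (e ▸ hq')
    have e2 := h.inv.tendsto_pt hd (x := q) fun e => disjoint_right.1 hAB hq (e ▸ hp')
    have hfixq' : ∀ k : ℕ, (((g ^ k)⁻¹ : Γ) : M ≃ₜ M) q = q := fun k =>
      ((g ^ k : Γ) : M ≃ₜ M).symm_apply_eq.2 (hfixq k).symm
    simp only [hfixp] at e1
    simp only [hfixq'] at e2
    obtain rfl := tendsto_nhds_unique tendsto_const_nhds e1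
    obtain rfl := tendsto_nhds_unique tendsto_const_nhds e2
    exact ⟨ψ, hψ, h⟩
  refine ⟨p, hp, q, hq, hpq, hgp, hgq, convLocUnif_of_subseq fun φ hφ => ?_,
    convLocUnif_of_subseq fun φ hφ => ?_⟩
  · obtain ⟨ψ, hψ, h⟩ := key' φ hφ
    exact ⟨ψ, hψ, by simpa using h.convLocUnif hd⟩
  · obtain ⟨ψ, hψ, h⟩ := key' φ hφ
    exact ⟨ψ, hψ, by simpa using h.inv.convLocUnif hd⟩

/-- Ping-pong on closed `r`-balls around `a` and `b`, where `r` is at most a third of their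
distance. The bounds are uniform in `n`: the first is what properness of `σ` requires, the second
keeps the attracting point away from `(γ n)⁻¹`, which tends to `b`. -/
theorem ConvergesTo.eventually_isLoxodromic (hd : IsCompactifying Γ) {γ : ℕ → Γ} {a b c : M}
    (h : ConvergesTo γ a b) (hab : a ≠ b) (hca : c ≠ a) (hcb : c ≠ b) :
    ∃ r > 0, ∀ᶠ n in atTop, ∃ p q, IsLoxodromic (γ n : M ≃ₜ M) p q ∧
      r ≤ dist (Bord.pt q : Bord Γ) (Bord.pt p) ∧ r ≤ dist (Bord.pt p : Bord Γ) (Bord.pt b) := by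
  have hD : ∀ {x y : M}, x ≠ y → 0 < dist (Bord.pt x : Bord Γ) (Bord.pt y) := fun h =>
    dist_pos.2 (Bord.pt_injective.ne h)
  have hpt := hd.embedding_pt.continuous
  obtain ⟨r, hr, hr1, hr2, hr3⟩ : ∃ r > 0, 3 * r ≤ dist (Bord.pt a : Bord Γ) (Bord.pt b) ∧
      r < dist (Bord.pt c : Bord Γ) (Bord.pt a) ∧ r < dist (Bord.pt c : Bord Γ) (Bord.pt b) := by
    have h1 := hD hab
    have h2 := hD hca
    have h3 := hD hcb
    obtain ⟨r, hr, hr'⟩ := exists_between (lt_min (div_pos h1 three_pos) (lt_min h2 h3))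
    rw [lt_min_iff, lt_min_iff] at hr'
    exact ⟨r, hr, by linarith [hr'.1], hr'.2⟩
  let A : Set M := {x | dist (Bord.pt x : Bord Γ) (Bord.pt a) ≤ r}
  let B : Set M := {x | dist (Bord.pt x : Bord Γ) (Bord.pt b) ≤ r}
  have hA : IsClosed A := isClosed_le (hpt.dist continuous_const) continuous_const
  have hB : IsClosed B := isClosed_le (hpt.dist continuous_const) continuous_const
  have hAn : A ∈ 𝓝 a := by
    filter_upwards [(hpt.dist continuous_const).continuousAt.eventually_lt (x₀ := a)
      (f := fun x => dist (Bord.pt x : Bord Γ) (Bord.pt a)) (g := fun _ => r)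
      continuousAt_const (by simpa using hr)] with x hx using hx.le
  have hBn : B ∈ 𝓝 b := by
    filter_upwards [(hpt.dist continuous_const).continuousAt.eventually_lt (x₀ := b)
      (f := fun x => dist (Bord.pt x : Bord Γ) (Bord.pt b)) (g := fun _ => r)
      continuousAt_const (by simpa using hr)] with x hx using hx.le
  have hfar : ∀ x ∈ A, ∀ y ∈ B, r ≤ dist (Bord.pt x : Bord Γ) (Bord.pt y) := by
    intro x (hx : dist _ _ ≤ _) y (hy : dist _ _ ≤ _)
    have := dist_triangle4 (Bord.pt a : Bord Γ) (Bord.pt x) (Bord.pt y) (Bord.pt b)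
    rw [dist_comm (Bord.pt a : Bord Γ) (Bord.pt x)] at this
    linarith
  have hAB : Disjoint A B := disjoint_left.2 fun x hx hx' => by
    have := hfar x hx x hx'
    rw [dist_self] at this
    linarith
  have hK : ∀ x : M, IsCompact {y : M | r ≤ dist (Bord.pt y : Bord Γ) (Bord.pt x)} := fun x =>
    (isClosed_le continuous_const (hpt.dist continuous_const)).isCompact
  have h1 := (h.convLocUnif hd).eventually_mapsTo (hK b) (by simpa using hr) hAn
  have h2 := (h.inv.convLocUnif hd).eventually_mapsTo (hK a) (by simpa using hr) hBn
  refine ⟨r, hr, ?_⟩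
  filter_upwards [h1, h2] with n h1 h2
  obtain ⟨p, hp, q, hq, hl⟩ := hd.exists_isLoxodromic_of_pingPong (γ n) hA hB hAB (c := c)
    (not_le.2 hr2) (not_le.2 hr3) (fun x hx => h1 (show r ≤ _ from le_of_lt (not_le.1 hx)))
    (fun x hx => h2 (show r ≤ _ from le_of_lt (not_le.1 hx)))
  exact ⟨p, q, hl, by rw [dist_comm]; exact hfar p hp q hq, hfar p hp b (by simpa [B] using hr.le)⟩

/-- A non-elementary convergence group has no global fixed point. -/
theorem IsCompactifying.exists_apply_ne (hd : IsCompactifying Γ) (hne : IsNonElementary Γ)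
    (z : M) : ∃ g : Γ, (g : M ≃ₜ M) z ≠ z := by
  by_contra! hz
  have hrep : ∀ {γ : ℕ → Γ} {a b : M}, ConvergesTo γ a b → a ≠ z → b = z := by
    intro γ a b h ha
    by_contra hb
    have := h.tendsto_pt hd (x := z) (Ne.symm hb)
    simp only [hz] at this
    exact ha (tendsto_nhds_unique this tendsto_const_nhds)
  -- A sequence with attracting point other than `z` must repel from `z`. It yields loxodromic
  -- elements, and a point fixed by a loxodromic is one of its two fixed points; inverting makes it
  -- the repelling one.
  obtain ⟨g, p, hg⟩ : ∃ (g : Γ) (p : M), IsLoxodromic (g : M ≃ₜ M) p z := by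
    obtain ⟨a, haL, haz, -⟩ := hne.exists_mem_limitSet_ne z z
    obtain ⟨c, -, hcz, hca⟩ := hne.exists_mem_limitSet_ne z a
    obtain ⟨γ, b, h⟩ := hd.exists_convergesTo_of_mem_limitSet hne haL
    obtain rfl := hrep h haz
    obtain ⟨r, -, hev⟩ := h.eventually_isLoxodromic hd haz hca hcz
    obtain ⟨n, p, q, hl, -, -⟩ := hev.exists
    by_cases hq : b = q
    · exact ⟨γ n, p, hq ▸ hl⟩
    · have hfix : ∀ k : ℕ, ((γ n : M ≃ₜ M) ^ k) b = b := fun k => by simpa using hz (γ n ^ k)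
      have := hl.tendsto hq
      simp only [hfix] at this
      obtain rfl := tendsto_nhds_unique tendsto_const_nhds this
      exact ⟨(γ n)⁻¹, q, hl.inv⟩
  have hpz := hg.1
  obtain ⟨h, hhp⟩ : ∃ h : Γ, (h : M ≃ₜ M) p ≠ p := by
    by_contra! hp
    obtain ⟨a, haL, haz, hap⟩ := hne.exists_mem_limitSet_ne z p
    obtain ⟨γ, b, h⟩ := hd.exists_convergesTo_of_mem_limitSet hne haL
    obtain rfl := hrep h haz
    have := h.tendsto_pt hd hpz
    simp only [hp] at this
    exact hap (tendsto_nhds_unique this tendsto_const_nhds)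
  have hhpz : (h : M ≃ₜ M) p ≠ z := fun e => hpz ((h : M ≃ₜ M).injective (e.trans (hz h).symm))
  have hhp' : ((h⁻¹ : Γ) : M ≃ₜ M) p ≠ p := fun e =>
    hhp ((h : M ≃ₜ M).symm_apply_eq.1 e).symm
  -- The conjugate of `g` by `h` also fixes `z`, so its inverse powers pull `p` towards `z`, while
  -- positive powers of `g` push it back out. The product `f n`, stopped at the first exit time `m
  -- n` from a neighbourhood `U` of `z`, will violate the convergence property.
  let y : ℕ → M := fun n => (h : M ≃ₜ M) (((g⁻¹ ^ n : Γ) : M ≃ₜ M) (((h⁻¹ : Γ) : M ≃ₜ M) p))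
  have hy : Tendsto y atTop (𝓝 z) := by
    have h1 : Tendsto (fun n : ℕ => ((g⁻¹ ^ n : Γ) : M ≃ₜ M) (((h⁻¹ : Γ) : M ≃ₜ M) p)) atTop
        (𝓝 z) := by simpa using hg.inv.tendsto hhp'
    have h2 := ((h : M ≃ₜ M).continuous.tendsto z).comp h1
    rwa [hz h] at h2
  have hyz : ∀ n, y n ≠ z := fun n e => hpz <|
    (h * g⁻¹ ^ n * h⁻¹ : Γ).1.injective (e.trans (hz (h * g⁻¹ ^ n * h⁻¹)).symm)
  set r := dist (Bord.pt p : Bord Γ) (Bord.pt z) / 2 with hr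
  have hrpos : 0 < r := half_pos (dist_pos.2 (Bord.pt_injective.ne hpz))
  let U : Set M := {x | dist (Bord.pt x : Bord Γ) (Bord.pt z) < r}
  have hU : IsOpen U :=
    isOpen_lt (hd.embedding_pt.continuous.dist continuous_const) continuous_const
  have hzU : z ∈ U := by simpa [U] using hrpos
  have hUp : ∀ᶠ x in 𝓝 p, x ∉ U := by
    have : IsOpen {x : M | r < dist (Bord.pt x : Bord Γ) (Bord.pt z)} :=
      isOpen_lt continuous_const (hd.embedding_pt.continuous.dist continuous_const)
    filter_upwards [this.mem_nhds (show r < _ by linarith)] with x hx using not_lt.2 (le_of_lt hx)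
  have hgt : ∀ {x : M}, x ≠ z → Tendsto (fun n : ℕ => ((g ^ n : Γ) : M ≃ₜ M) x) atTop (𝓝 p) :=
    fun hx => by simpa using hg.tendsto hx
  have hex : ∀ n, ∃ m : ℕ, ((g ^ m : Γ) : M ≃ₜ M) (y n) ∉ U := fun n =>
    ((hgt (hyz n)).eventually hUp).exists
  classical
  let m : ℕ → ℕ := fun n => Nat.find (hex n)
  have hm : Tendsto m atTop atTop := by
    refine tendsto_atTop.2 fun k => ?_
    have h1 : ∀ j : ℕ, ∀ᶠ n in atTop, ((g ^ j : Γ) : M ≃ₜ M) (y n) ∈ U := fun j => by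
      have h2 := (((g ^ j : Γ) : M ≃ₜ M).continuous.tendsto z).comp hy
      rw [hz] at h2
      exact h2.eventually (hU.mem_nhds hzU)
    filter_upwards [(Filter.eventually_all_finite (finite_Iio k)).2 fun j _ => h1 j] with n hn
    exact (Nat.le_find_iff _ _).2 fun j hj => not_not.2 (hn j hj)
  let f : ℕ → Γ := fun n => g ^ m n * (h * g⁻¹ ^ n * h⁻¹)
  have hfU : ∀ n, (f n : M ≃ₜ M) p ∉ U := fun n => Nat.find_spec (hex n)
  have hfhp : ∀ n, (f n : M ≃ₜ M) ((h : M ≃ₜ M) p) = ((g ^ m n : Γ) : M ≃ₜ M) ((h : M ≃ₜ M) p) := by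
    intro n
    have hgp : ((g⁻¹ ^ n : Γ) : M ≃ₜ M) p = p := by
      induction n with
      | zero => rfl
      | succ n ih => rw [pow_succ]; exact (congrArg _ hg.inv.2.2.1).trans ih
    have e : ((h⁻¹ : Γ) : M ≃ₜ M) ((h : M ≃ₜ M) p) = p := (h : M ≃ₜ M).symm_apply_apply p
    change ((g ^ m n : Γ) : M ≃ₜ M) ((h : M ≃ₜ M) (((g⁻¹ ^ n : Γ) : M ≃ₜ M)
      (((h⁻¹ : Γ) : M ≃ₜ M) ((h : M ≃ₜ M) p)))) = _
    rw [e, hgp]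
  have hlim : Tendsto (fun n => (f n : M ≃ₜ M) ((h : M ≃ₜ M) p)) atTop (𝓝 p) := by
    simp only [hfhp]
    exact (hgt hhpz).comp hm
  obtain ⟨φ, hφ, ⟨k, hk⟩ | ⟨a, b, hab⟩⟩ := hd.exists_subseq f
  · have h1 := hlim.comp hφ.tendsto_atTop
    simp only [Function.comp_def, hk] at h1
    have h2 := tendsto_nhds_unique tendsto_const_nhds h1
    rw [← hk 0, hfhp] at h2
    have hgp : ∀ j : ℕ, ((g ^ j : Γ) : M ≃ₜ M) p = p := fun j => by
      induction j with
      | zero => rfl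
      | succ n ih => rw [pow_succ]; exact (congrArg _ hg.2.1).trans ih
    exact hhp (((g ^ m (φ 0) : Γ) : M ≃ₜ M).injective (h2.trans (hgp _).symm))
  -- If `z` repels, both `p` and `h p` are sent to the attracting point, which is `p`. Then `g⁻¹ * f
  -- n` also sends `p` towards `p`, although by minimality of the exit time its image is still in
  -- `U`.
  · by_cases hbz : b = z
    · subst hbz
      obtain rfl := tendsto_nhds_unique (hab.tendsto_pt hd hhpz) (hlim.comp hφ.tendsto_atTop)
      have h1 := (((g⁻¹ : Γ) : M ≃ₜ M).continuous.tendsto a).comp (hab.tendsto_pt hd hpz)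
      rw [show ((g⁻¹ : Γ) : M ≃ₜ M) a = a from hg.inv.2.2.1] at h1
      have h2 := ((hm.comp hφ.tendsto_atTop).eventually (eventually_ge_atTop 1))
      obtain ⟨n, hn1, hn2⟩ := ((h1.eventually hUp).and h2).exists
      apply hn1
      have hlt : m (φ n) - 1 < m (φ n) := by simp only [Function.comp] at hn2; omega
      have h3 := not_not.1 (Nat.find_min (hex (φ n)) hlt)
      have e : g⁻¹ * f (φ n) = g ^ (m (φ n) - 1) * (h * g⁻¹ ^ (φ n) * h⁻¹) := by
        have : g ^ m (φ n) = g * g ^ (m (φ n) - 1) := by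
          rw [← pow_succ', Nat.sub_add_cancel (show 1 ≤ m (φ n) from hn2)]
        simp only [f, this]
        group
      have e2 : ((g⁻¹ * f (φ n) : Γ) : M ≃ₜ M) a ∈ U := by rw [e]; exact h3
      exact e2
    -- Otherwise the fixed point `z` attracts. At least one of `p` and `h p` is not the repelling
    -- point and would tend to `z`, but the first stays outside `U` and the second tends to `p`.
    · have h1 := hab.tendsto_pt hd (x := z) (Ne.symm hbz)
      simp only [hz] at h1
      obtain rfl := tendsto_nhds_unique tendsto_const_nhds h1
      by_cases hb : (h : M ≃ₜ M) p = b
      · have h2 := hab.tendsto_pt hd (x := p) (fun e => hhp (hb.trans e.symm))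
        obtain ⟨n, hn⟩ := (h2.eventually (hU.mem_nhds hzU)).exists
        exact hfU _ hn
      · exact hpz (tendsto_nhds_unique (hlim.comp hφ.tendsto_atTop) (hab.tendsto_pt hd hb))

end

/-! ### Cocycle estimates, shadows and growth of magnitudes. -/

section

variable {M : Type*} [TopologicalSpace M] {Γ : Subgroup (M ≃ₜ M)} {κ : ℝ} {σ : Γ → M → ℝ}

namespace IsCoarseCocycle

theorem abs_mul_sub_le (hσ : IsCoarseCocycle Γ κ σ) (γ η : Γ) (x : M) :
    |σ (γ * η) x - σ γ ((η : M ≃ₜ M) x) - σ η x| ≤ κ := by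
  have := hσ.coarse_cocycle γ η x
  rwa [← sub_sub] at this

theorem abs_one_le (hσ : IsCoarseCocycle Γ κ σ) (x : M) : |σ 1 x| ≤ κ := by
  have := hσ.abs_mul_sub_le 1 1 x
  rw [mul_one] at this
  change |σ 1 x - σ 1 x - σ 1 x| ≤ κ at this
  rwa [sub_self, zero_sub, abs_neg] at this

theorem abs_add_inv_le (hσ : IsCoarseCocycle Γ κ σ) (γ : Γ) (x : M) :
    |σ γ (((γ⁻¹ : Γ) : M ≃ₜ M) x) + σ γ⁻¹ x| ≤ 2 * κ := by
  have h1 := abs_le.1 (hσ.abs_mul_sub_le γ γ⁻¹ x)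
  rw [mul_inv_cancel] at h1
  have h2 := abs_le.1 (hσ.abs_one_le x)
  exact abs_le.2 ⟨by linarith [h1.2, h2.1], by linarith [h1.1, h2.2]⟩

end IsCoarseCocycle

variable [MetricSpace (Bord Γ)] {N : Γ → ℝ}

theorem ConvergesTo.mul_right (hd : IsCompactifying Γ) {γ : ℕ → Γ} {a b : M}
    (h : ConvergesTo γ a b) (g : Γ) :
    ConvergesTo (fun n => γ n * g) a (((g⁻¹ : Γ) : M ≃ₜ M) b) := by
  constructor
  · refine convLocUnif_compl_singleton_iff.2 fun z hz => ?_
    have hz' : Bord.act Γ g z ≠ Bord.pt b := fun e => hz (by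
      rw [← Bord.act_inv_act g z, e]; rfl)
    have := (convLocUnif_compl_singleton_iff.1 h.fwd _ hz').comp
      (tendsto_id.prodMap ((hd.continuous_act g).tendsto z))
    exact this.congr fun p => (Bord.act_mul _ _ _).symm
  · refine convLocUnif_compl_singleton_iff.2 fun z hz => ?_
    have := ((hd.continuous_act g⁻¹).tendsto _).comp (convLocUnif_compl_singleton_iff.1 h.bwd _ hz)
    refine this.congr fun p => ?_
    simp only [Function.comp, mul_inv_rev, Bord.act_mul]

theorem ConvergesTo.tendsto_cofinite {γ : ℕ → Γ} {a b : M}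
    (h : ConvergesTo γ a b) : Tendsto γ atTop cofinite := by
  refine (hasBasis_cofinite.tendsto_right_iff).2 fun s hs => ?_
  have := (Filter.eventually_all_finite hs).2 fun g _ => h.tendsto_elt.eventually
    (isClosed_singleton.isOpen_compl.mem_nhds (show (Bord.pt a : Bord Γ) ∈ {Bord.elt g}ᶜ by simp))
  filter_upwards [this] with n hn hmem using hn _ hmem rfl

/-- The shadow of `γ`: the image under `γ` of the complement of the `ε`-ball around `γ⁻¹`. -/
def shadow (ε : ℝ) (γ : Γ) : Set M :=
  {x | ε ≤ dist (Bord.pt (((γ⁻¹ : Γ) : M ≃ₜ M) x) : Bord Γ) (Bord.elt γ⁻¹)}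

theorem shadow_anti {ε ε' : ℝ} (h : ε ≤ ε') (γ : Γ) : shadow ε' γ ⊆ shadow ε γ :=
  fun _ hx => h.trans hx

theorem isClosed_shadow (hd : IsCompactifying Γ) (ε : ℝ) (γ : Γ) : IsClosed (shadow ε γ) :=
  isClosed_le continuous_const ((hd.embedding_pt.continuous.comp
    ((γ⁻¹ : Γ) : M ≃ₜ M).continuous).dist continuous_const)

variable [CompactSpace M] [TopologicalSpace.MetrizableSpace M]

/-- Eventually the `γ n` are loxodromic with separated fixed points, and the attracting one is far
from `(γ n)⁻¹`. There `σ` is at most the magnitude plus a constant, so properness applies. -/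
theorem ConvergesTo.tendsto_magnitude_of_ne (hd : IsCompactifying Γ) (hne : IsNonElementary Γ)
    (hp : IsProperCocycle Γ σ) (hN : IsMagnitude Γ σ N) {γ : ℕ → Γ}
    (hγ : Function.Injective γ) {a b : M} (h : ConvergesTo γ a b) (hab : a ≠ b) :
    Tendsto (fun n => N (γ n)) atTop atTop := by
  obtain ⟨c, -, hca, hcb⟩ := hne.exists_mem_limitSet_ne a b
  obtain ⟨r, hr, hev⟩ := h.eventually_isLoxodromic hd hab hca hcb
  have hlim := h.inv.tendsto_elt.eventually (Metric.ball_mem_nhds _ (half_pos hr))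
  obtain ⟨n₀, hn₀⟩ := eventually_atTop.1 (hev.and hlim)
  rw [← tendsto_add_atTop_iff_nat n₀]
  choose p q hl hqp hpb using fun n => (hn₀ (n + n₀) (Nat.le_add_left _ _)).1
  have h1 := hp (fun n => γ (n + n₀)) p q (fun m n e => Nat.add_right_cancel (hγ e)) hl
    ⟨r, hr, Eventually.of_forall hqp⟩
  obtain ⟨C, -, hC⟩ := hN (r / 2) (half_pos hr)
  refine tendsto_atTop_mono (fun n => ?_) (tendsto_atTop_add_const_right _ (-C) h1)
  have h2 : dist (Bord.elt (γ (n + n₀))⁻¹ : Bord Γ) (Bord.pt b) < r / 2 :=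
    (hn₀ (n + n₀) (Nat.le_add_left _ _)).2
  have h3 := dist_triangle (Bord.pt (p n) : Bord Γ) (Bord.elt (γ (n + n₀))⁻¹) (Bord.pt b)
  linarith [(hC (p n) (γ (n + n₀)) (by linarith [hpb n])).2]

/-- When `a = b`, right multiplication by some `g` moving `a` separates the two points. It changes
the magnitude by a bounded amount, as seen by evaluating the cocycle at a point `x` for which `x`
and `g x` avoid the respective repelling points. -/
theorem ConvergesTo.tendsto_magnitude (hd : IsCompactifying Γ) (hne : IsNonElementary Γ)
    (hσ : IsCoarseCocycle Γ κ σ) (hp : IsProperCocycle Γ σ) (hN : IsMagnitude Γ σ N) {γ : ℕ → Γ}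
    (hγ : Function.Injective γ) {a b : M} (h : ConvergesTo γ a b) :
    Tendsto (fun n => N (γ n)) atTop atTop := by
  by_cases hab : a = b
  · subst hab
    obtain ⟨g, hg⟩ := hd.exists_apply_ne hne a
    have hga : a ≠ ((g⁻¹ : Γ) : M ≃ₜ M) a := fun e => hg ((g : M ≃ₜ M).eq_symm_apply.1 e)
    have h' := h.mul_right hd g
    have h1 := h'.tendsto_magnitude_of_ne hd hne hp hN
      (fun m n e => hγ (mul_right_cancel e)) hga
    obtain ⟨x, -, hx, -⟩ := hne.exists_mem_limitSet_ne (((g⁻¹ : Γ) : M ≃ₜ M) a) a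
    have hgx : (g : M ≃ₜ M) x ≠ a := fun e => hx ((g : M ≃ₜ M).eq_symm_apply.2 e)
    set r := min (dist (Bord.pt x : Bord Γ) (Bord.pt (((g⁻¹ : Γ) : M ≃ₜ M) a)))
      (dist (Bord.pt ((g : M ≃ₜ M) x) : Bord Γ) (Bord.pt a)) with hr
    have hrpos : 0 < r := lt_min (dist_pos.2 (Bord.pt_injective.ne hx))
      (dist_pos.2 (Bord.pt_injective.ne hgx))
    obtain ⟨C, -, hC⟩ := hN (r / 2) (half_pos hrpos)
    refine tendsto_atTop_mono' _ ?_
      (tendsto_atTop_add_const_right _ (-(2 * C + κ + |σ g x|)) h1)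
    filter_upwards [h.inv.tendsto_elt.eventually (Metric.ball_mem_nhds _ (half_pos hrpos)),
      h'.inv.tendsto_elt.eventually (Metric.ball_mem_nhds _ (half_pos hrpos))] with n h2 h3
    have h2 : dist (Bord.elt (γ n)⁻¹ : Bord Γ) (Bord.pt a) < r / 2 := h2
    have h3 : dist (Bord.elt (γ n * g)⁻¹ : Bord Γ)
      (Bord.pt (((g⁻¹ : Γ) : M ≃ₜ M) a)) < r / 2 := h3
    have e2 := dist_triangle (Bord.pt ((g : M ≃ₜ M) x) : Bord Γ) (Bord.elt (γ n)⁻¹) (Bord.pt a)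
    have e3 := dist_triangle (Bord.pt x : Bord Γ) (Bord.elt (γ n * g)⁻¹)
      (Bord.pt (((g⁻¹ : Γ) : M ≃ₜ M) a))
    have f2 := (hC ((g : M ≃ₜ M) x) (γ n)
      (by linarith [min_le_right _ _ |>.trans_eq' hr]))
    have f3 := (hC x (γ n * g) (by linarith [min_le_left _ _ |>.trans_eq' hr]))
    have f4 := abs_le.1 (hσ.abs_mul_sub_le (γ n) g x)
    have f5 := le_abs_self (σ g x)
    linarith [f2.2, f3.1, f4.2]
  · exact h.tendsto_magnitude_of_ne hd hne hp hN hγ hab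

theorem IsMagnitude.finite_le (hN : IsMagnitude Γ σ N) (hd : IsCompactifying Γ)
    (hne : IsNonElementary Γ) (hσ : IsCoarseCocycle Γ κ σ) (hp : IsProperCocycle Γ σ) (T : ℝ) :
    {γ : Γ | N γ ≤ T}.Finite := by
  by_contra hinf
  let f := Set.Infinite.natEmbedding _ hinf
  have hf : Function.Injective fun n => (f n : Γ) := Subtype.val_injective.comp f.injective
  obtain ⟨φ, a, b, hφ, h⟩ := hd.exists_convergesTo hf
  have h1 := h.tendsto_magnitude hd hne hσ hp hN (hf.comp hφ.injective)
  obtain ⟨n, hn⟩ := (h1.eventually (eventually_gt_atTop T)).exists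
  exact not_le.2 hn (f (φ n)).2

theorem IsMagnitude.tendsto_cofinite (hN : IsMagnitude Γ σ N) (hd : IsCompactifying Γ)
    (hne : IsNonElementary Γ) (hσ : IsCoarseCocycle Γ κ σ) (hp : IsProperCocycle Γ σ) :
    Tendsto N cofinite atTop := by
  refine tendsto_atTop.2 fun T => ?_
  filter_upwards [(hN.finite_le hd hne hσ hp T).compl_mem_cofinite] with γ hγ
  exact (not_le.1 (show ¬ N γ ≤ T from hγ)).le

end

/-! ### Geometry of shadows. -/

section

variable {M : Type*} [TopologicalSpace M] {Γ : Subgroup (M ≃ₜ M)} {κ : ℝ} {σ : Γ → M → ℝ}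
  [MetricSpace (Bord Γ)] {N : Γ → ℝ}

/-- The points lying in infinitely many `ε`-shadows. -/
def limsupShadow (Γ : Subgroup (M ≃ₜ M)) [MetricSpace (Bord Γ)] (ε : ℝ) : Set M :=
  {x | {γ : Γ | x ∈ shadow ε γ}.Infinite}

theorem apply_mem_uniformConicalLimitSet {ε : ℝ} {x : M} (g : Γ)
    (hx : (g : M ≃ₜ M) x ∈ uniformConicalLimitSet Γ ε) : x ∈ uniformConicalLimitSet Γ ε := by
  obtain ⟨a, b, γ, hab, hb, ha⟩ := hx
  exact ⟨a, b, fun n => γ n * g, hab, hb, fun y hy => ha _ ((g : M ≃ₜ M).injective.ne hy)⟩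

theorem uniformConicalLimitSet_anti {ε ε' : ℝ} (h : ε ≤ ε') :
    uniformConicalLimitSet Γ ε' ⊆ uniformConicalLimitSet Γ ε := by
  rintro x ⟨a, b, γ, hab, hx⟩
  exact ⟨a, b, γ, h.trans hab, hx⟩

theorem shadow_eq_preimage (ε : ℝ) (γ : Γ) : (shadow ε γ : Set M) = ((γ⁻¹ : Γ) : M ≃ₜ M) ⁻¹'
    {y | ε ≤ dist (Bord.pt y : Bord Γ) (Bord.elt γ⁻¹)} := rfl

section

variable [MeasurableSpace M] [BorelSpace M]

theorem measurableSet_compl_ball (hd : IsCompactifying Γ) (ε : ℝ) (p : Bord Γ) :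
    MeasurableSet {y : M | ε ≤ dist (Bord.pt y : Bord Γ) p} :=
  (isClosed_le continuous_const
    (hd.embedding_pt.continuous.dist continuous_const)).measurableSet

theorem measurableSet_limsupShadow (hd : IsCompactifying Γ) (ε : ℝ) :
    MeasurableSet (limsupShadow Γ ε) := by
  have := hd.countable
  have heq : limsupShadow Γ ε = ⋂ s : Finset Γ, ⋃ γ : Γ, ⋃ _ : γ ∉ s, shadow ε γ := by
    ext x
    simp only [limsupShadow, mem_ofPred_eq, mem_iInter, mem_iUnion, exists_prop]
    refine ⟨fun h s => ?_, fun h hfin => ?_⟩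
    · obtain ⟨γ, hγ, hγs⟩ := h.exists_notMem_finset s
      exact ⟨γ, hγs, hγ⟩
    · obtain ⟨γ, hγs, hγ⟩ := h hfin.toFinset
      exact hγs (hfin.mem_toFinset.2 hγ)
  rw [heq]
  exact .iInter fun s => .iUnion fun γ => .iUnion fun _ => (isClosed_shadow hd ε γ).measurableSet

end

variable [CompactSpace M]

theorem tendsto_nhds_of_dist_lt {X : Type*} [PseudoMetricSpace X] {u v : ℕ → X} {p : X}
    {φ : ℕ → ℕ} (hφ : StrictMono φ) (hu : Tendsto u atTop (𝓝 p))
    (h : ∀ n, dist (u n) (v n) < 1 / ((φ n : ℝ) + 1)) : Tendsto v atTop (𝓝 p) := by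
  have h0 : Tendsto (fun n => dist (u n) (v n)) atTop (𝓝 0) :=
    squeeze_zero (fun _ => dist_nonneg) (fun n => (h n).le)
      (tendsto_one_div_add_atTop_nhds_zero_nat.comp hφ.tendsto_atTop)
  exact (tendsto_iff_of_dist h0).1 hu

/-- Put `α = γ⁻¹ * η`. If `η⁻¹ x` came arbitrarily close to `α⁻¹`, then `α` would diverge, and both
`γ⁻¹` and `α` would approach its attracting point. The cocycle along `η = γ * α` would then give `N
η ≈ N γ - N α⁻¹` with `N α⁻¹` unbounded, against the assumption on magnitudes. -/
theorem IsMagnitude.exists_le_dist_of_mem_shadow (hN : IsMagnitude Γ σ N)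
    (hd : IsCompactifying Γ) (hσ : IsCoarseCocycle Γ κ σ) (hNt : Tendsto N cofinite atTop)
    {ε : ℝ} (hε : 0 < ε) (c : ℝ) :
    ∃ ε' > 0, ∀ (γ η : Γ) (x : M), N γ ≤ N η + c → x ∈ shadow ε γ → x ∈ shadow ε η →
      ε' ≤ dist (Bord.pt (((η⁻¹ : Γ) : M ≃ₜ M) x) : Bord Γ) (Bord.elt (η⁻¹ * γ)) := by
  by_contra! hcon
  have := hd.compact
  choose γ η x hNle hxγ hxη hlt using fun n : ℕ => hcon (1 / ((n : ℝ) + 1)) (by positivity)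
  obtain ⟨φ₁, hφ₁, hα⟩ := hd.exists_subseq fun n => (γ n)⁻¹ * η n
  obtain ⟨w, -, φ₂, hφ₂, hw⟩ := isCompact_univ.tendsto_subseq
    (x := fun n => (Bord.elt (η (φ₁ n))⁻¹ : Bord Γ)) fun _ => mem_univ _
  set φ := fun n => φ₁ (φ₂ n) with hφdef
  have hφ : StrictMono φ := hφ₁.comp hφ₂
  have hαinv : ∀ n, ((γ n)⁻¹ * η n)⁻¹ = (η n)⁻¹ * γ n := fun n => by group
  rcases hα with ⟨g, hg⟩ | ⟨a, b, hab⟩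
  · have h1 : ∀ n, (η (φ n))⁻¹ * γ (φ n) = g⁻¹ := fun n => by rw [← hαinv]; exact congrArg _ (hg _)
    have h2 := tendsto_nhds_of_dist_lt hφ
      (tendsto_const_nhds (x := (Bord.elt g⁻¹ : Bord Γ))) fun n => by
        rw [← h1 n, dist_comm]; exact hlt (φ n)
    obtain ⟨y, hy⟩ := hd.isClosed_range_pt.mem_of_tendsto h2
      (Eventually.of_forall fun n => mem_range_self _)
    cases hy
  · replace hab := hab.subseq hφ₂
    have hu : Tendsto (fun n => (Bord.pt ((((η (φ n))⁻¹ : Γ) : M ≃ₜ M) (x (φ n))) : Bord Γ)) atTop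
        (𝓝 (Bord.pt b)) := by
      refine tendsto_nhds_of_dist_lt hφ hab.inv.tendsto_elt fun n => ?_
      rw [dist_comm, hαinv]
      exact hlt (φ n)
    have hwb : w ≠ Bord.pt b := by
      rintro rfl
      have h1 := hu.dist hw
      rw [dist_self] at h1
      exact not_le.2 hε (ge_of_tendsto h1 (Eventually.of_forall fun n => hxη _))
    have hγa : Tendsto (fun n => (Bord.elt (γ (φ n))⁻¹ : Bord Γ)) atTop (𝓝 (Bord.pt a)) := by
      refine (hab.tendsto hw hwb).congr fun n => ?_
      simp [Bord.act, φ]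
    obtain ⟨C, -, hC⟩ := hN (ε / 2) (half_pos hε)
    have hNinf := (hNt.comp hab.inv.tendsto_cofinite).eventually
      -- Three magnitude estimates cost `3 * C`; the cocycle relation costs `κ` and passing to the
      -- inverse `2 * κ`.
      (eventually_gt_atTop (3 * C + c + 3 * κ))
    have hclose := (hγa.dist hab.tendsto_elt).eventually_lt_const
      (u := ε / 2) (by simpa using hε)
    obtain ⟨n, hn1, hn2⟩ := (hNinf.and hclose).exists
    change 3 * C + c + 3 * κ < N ((γ (φ n))⁻¹ * η (φ n))⁻¹ at hn1
    change dist _ (Bord.elt ((γ (φ n))⁻¹ * η (φ n)) : Bord Γ) < _ at hn2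
    generalize φ n = m at hn1 hn2
    have e1 := hxγ m
    have e2 := hxη m
    simp only [shadow, mem_ofPred_eq] at e1 e2
    have h1 := hC ((((γ m)⁻¹ : Γ) : M ≃ₜ M) (x m)) (γ m) (by linarith)
    have h2 := hC ((((η m)⁻¹ : Γ) : M ≃ₜ M) (x m)) (η m) (by linarith)
    have h3 := hC ((((γ m)⁻¹ : Γ) : M ≃ₜ M) (x m)) ((γ m)⁻¹ * η m)⁻¹ (by
      rw [inv_inv]
      have := dist_triangle (Bord.pt ((((γ m)⁻¹ : Γ) : M ≃ₜ M) (x m)) : Bord Γ)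
        (Bord.elt ((γ m)⁻¹ * η m)) (Bord.elt (γ m)⁻¹)
      rw [dist_comm (Bord.elt ((γ m)⁻¹ * η m) : Bord Γ)] at this
      linarith)
    have h4 := abs_le.1 (hσ.abs_add_inv_le ((γ m)⁻¹ * η m) ((((γ m)⁻¹ : Γ) : M ≃ₜ M) (x m)))
    have h5 := abs_le.1 (hσ.abs_mul_sub_le (γ m) ((γ m)⁻¹ * η m)
      ((((η m)⁻¹ : Γ) : M ≃ₜ M) (x m)))
    have e3 : ((((γ m)⁻¹ * η m)⁻¹ : Γ) : M ≃ₜ M) ((((γ m)⁻¹ : Γ) : M ≃ₜ M) (x m)) =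
        (((η m)⁻¹ : Γ) : M ≃ₜ M) (x m) := by
      change (((((γ m)⁻¹ * η m)⁻¹ * (γ m)⁻¹ : Γ)) : M ≃ₜ M) (x m) = _
      congr 3
      group
    have e4 : (((γ m)⁻¹ * η m : Γ) : M ≃ₜ M) ((((η m)⁻¹ : Γ) : M ≃ₜ M) (x m)) =
        (((γ m)⁻¹ : Γ) : M ≃ₜ M) (x m) := by
      change ((((γ m)⁻¹ * η m) * (η m)⁻¹ : Γ) : M ≃ₜ M) (x m) = _
      congr 3
      group
    rw [e3] at h4
    rw [e4, mul_inv_cancel_left] at h5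
    have h6 := hNle m
    linarith [h1.2, h2.1, h3.1, h4.2, h5.2]

/-- Suppose `γ⁻¹ y` approaches `γ⁻¹` for some `y` in the shadow of `η`. If `γ⁻¹ * η` diverges, the
previous lemma keeps `η⁻¹ x` off its repelling point for a common point `x`, so `γ⁻¹ x` and `γ⁻¹`
have the same limit, which is impossible for `x` in the shadow of `γ`. If it stays constant, the
limits of `η⁻¹ y` and `η⁻¹` would coincide. -/
theorem IsMagnitude.exists_shadow_subset_shadow (hN : IsMagnitude Γ σ N)
    (hd : IsCompactifying Γ) (hσ : IsCoarseCocycle Γ κ σ) (hNt : Tendsto N cofinite atTop)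
    {ε : ℝ} (hε : 0 < ε) (c : ℝ) :
    ∃ ε' > 0, ∀ γ η : Γ, N γ ≤ N η + c → (shadow ε γ ∩ shadow ε η).Nonempty →
      shadow ε η ⊆ shadow ε' γ := by
  obtain ⟨ε₁, hε₁, hdist⟩ := hN.exists_le_dist_of_mem_shadow hd hσ hNt hε c
  by_contra! hcon
  have := hd.compact
  choose γ η hNle hne hsub using fun n : ℕ => hcon (1 / ((n : ℝ) + 1)) (by positivity)
  choose x hxγ hxη using hne
  choose y hyη hyγ using fun n => not_subset.1 (hsub n)
  obtain ⟨φ₁, hφ₁, hα⟩ := hd.exists_subseq fun n => (γ n)⁻¹ * η n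
  obtain ⟨⟨u, v, w⟩, -, φ₂, hφ₂, hlim⟩ := isCompact_univ.tendsto_subseq
    (x := fun n => ((Bord.pt ((((η (φ₁ n))⁻¹ : Γ) : M ≃ₜ M) (x (φ₁ n))) : Bord Γ),
      (Bord.pt ((((η (φ₁ n))⁻¹ : Γ) : M ≃ₜ M) (y (φ₁ n))) : Bord Γ),
      (Bord.elt (η (φ₁ n))⁻¹ : Bord Γ))) fun _ => mem_univ _
  set φ := fun n => φ₁ (φ₂ n) with hφdef
  have hφ : StrictMono φ := hφ₁.comp hφ₂
  have hu : Tendsto (fun n => (Bord.pt ((((η (φ n))⁻¹ : Γ) : M ≃ₜ M) (x (φ n))) : Bord Γ)) atTop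
    (𝓝 u) := hlim.fst_nhds
  have hv : Tendsto (fun n => (Bord.pt ((((η (φ n))⁻¹ : Γ) : M ≃ₜ M) (y (φ n))) : Bord Γ)) atTop
    (𝓝 v) := hlim.snd_nhds.fst_nhds
  have hw : Tendsto (fun n => (Bord.elt (η (φ n))⁻¹ : Bord Γ)) atTop (𝓝 w) :=
    hlim.snd_nhds.snd_nhds
  have hvw : v ≠ w := by
    rintro rfl
    have h1 := hv.dist hw
    rw [dist_self] at h1
    exact not_le.2 hε (ge_of_tendsto h1 (Eventually.of_forall fun n => hyη _))
  have hact : ∀ (n : ℕ) (z : M), Bord.act Γ ((γ n)⁻¹ * η n)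
      (Bord.pt ((((η n)⁻¹ : Γ) : M ≃ₜ M) z)) = Bord.pt ((((γ n)⁻¹ : Γ) : M ≃ₜ M) z) := by
    intro n z
    change Bord.pt ((((γ n)⁻¹ * η n * (η n)⁻¹ : Γ) : M ≃ₜ M) z) = _
    congr 4
    group
  have hact' : ∀ n : ℕ, Bord.act Γ ((γ n)⁻¹ * η n) (Bord.elt (η n)⁻¹) = Bord.elt (γ n)⁻¹ := by
    intro n
    simp [Bord.act]
  have hyγ' : ∀ n, dist (Bord.pt ((((γ (φ n))⁻¹ : Γ) : M ≃ₜ M) (y (φ n))) : Bord Γ)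
      (Bord.elt (γ (φ n))⁻¹) < 1 / ((φ n : ℝ) + 1) := fun n => not_le.1 (hyγ (φ n))
  rcases hα with ⟨g, hg⟩ | ⟨a, b, hab⟩
  · have h1 := ((hd.continuous_act g).tendsto v).comp hv
    have h2 := ((hd.continuous_act g).tendsto w).comp hw
    have h1' : Tendsto (fun n => (Bord.pt ((((γ (φ n))⁻¹ : Γ) : M ≃ₜ M) (y (φ n))) : Bord Γ)) atTop
        (𝓝 (Bord.act Γ g v)) := by
      refine h1.congr fun n => ?_
      rw [← hact, show (γ (φ n))⁻¹ * η (φ n) = g from hg _]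
      rfl
    have h2' : Tendsto (fun n => (Bord.elt (γ (φ n))⁻¹ : Bord Γ)) atTop
        (𝓝 (Bord.act Γ g w)) := by
      refine h2.congr fun n => ?_
      rw [← hact', show (γ (φ n))⁻¹ * η (φ n) = g from hg _]
      rfl
    exact hvw (Bord.act_injective g
      (tendsto_nhds_unique (tendsto_nhds_of_dist_lt hφ h1' hyγ') h2'))
  · replace hab := hab.subseq hφ₂
    have hub : u ≠ Bord.pt b := by
      rintro rfl
      have h1 := hu.dist hab.inv.tendsto_elt
      rw [dist_self] at h1
      refine not_le.2 hε₁ (ge_of_tendsto h1 (Eventually.of_forall fun n => ?_))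
      rw [show ((γ (φ₁ (φ₂ n)))⁻¹ * η (φ₁ (φ₂ n)))⁻¹ = (η (φ n))⁻¹ * γ (φ n) by simp [φ]]
      exact hdist _ _ _ (hNle _) (hxγ _) (hxη _)
    have hxa : Tendsto (fun n => (Bord.pt ((((γ (φ n))⁻¹ : Γ) : M ≃ₜ M) (x (φ n))) : Bord Γ)) atTop
        (𝓝 (Bord.pt a)) := (hab.tendsto hu hub).congr fun n => hact _ _
    have hγa : Tendsto (fun n => (Bord.elt (γ (φ n))⁻¹ : Bord Γ)) atTop (𝓝 (Bord.pt a)) := by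
      -- The limits `v` of `η⁻¹ y` and `w` of `η⁻¹` differ, so at least one of them is not repelled.
      by_cases hwb : w = Bord.pt b
      · exact tendsto_nhds_of_dist_lt hφ
          ((hab.tendsto hv (hwb ▸ hvw)).congr fun n => hact _ _) hyγ'
      · exact (hab.tendsto hw hwb).congr fun n => hact' _
    have h1 := hxa.dist hγa
    rw [dist_self] at h1
    exact not_le.2 hε (ge_of_tendsto h1 (Eventually.of_forall fun n => hxγ _))

variable [TopologicalSpace.MetrizableSpace M]

theorem ConvergesTo.exists_subseq_tendsto_of_mem_shadow (hd : IsCompactifying Γ) {ε : ℝ}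
    (hε : 0 < ε) {γ : ℕ → Γ} {a b : M} (h : ConvergesTo γ a b) {x : ℕ → M}
    (hx : ∀ n, x n ∈ shadow ε (γ n)) :
    ∃ (φ : ℕ → ℕ) (u : M), StrictMono φ ∧ ε ≤ dist (Bord.pt b : Bord Γ) (Bord.pt u) ∧
      Tendsto (fun n => (((γ (φ n))⁻¹ : Γ) : M ≃ₜ M) (x (φ n))) atTop (𝓝 u) ∧
      Tendsto (fun n => x (φ n)) atTop (𝓝 a) := by
  obtain ⟨u, -, φ, hφ, hu⟩ := isCompact_univ.tendsto_subseq
    (x := fun n => (((γ n)⁻¹ : Γ) : M ≃ₜ M) (x n)) fun _ => mem_univ _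
  have hu' := (hd.embedding_pt.continuous.tendsto u).comp hu
  have hbu : ε ≤ dist (Bord.pt b : Bord Γ) (Bord.pt u) := by
    rw [dist_comm]
    exact ge_of_tendsto (hu'.dist (h.subseq hφ).inv.tendsto_elt)
      (Eventually.of_forall fun n => hx _)
  refine ⟨φ, u, hφ, hbu, hu, hd.embedding_pt.tendsto_nhds_iff.2 ?_⟩
  refine ((h.subseq hφ).tendsto hu' ?_).congr fun n => ?_
  · intro e
    rw [e, dist_self] at hbu
    exact not_le.2 hε hbu
  · exact congrArg Bord.pt ((γ (φ n) : M ≃ₜ M).apply_symm_apply _)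

/-- Shadows along a convergent sequence shrink to its attracting point, which is `x` when all of
them contain `x`. This supplies the fine cover for the Vitali argument. -/
theorem exists_shadow_subset_of_mem_limsupShadow (hd : IsCompactifying Γ) {ε : ℝ} (hε : 0 < ε)
    {x : M} (hx : x ∈ limsupShadow Γ ε) {U : Set M} (hU : U ∈ 𝓝 x) :
    ∃ γ : Γ, x ∈ shadow ε γ ∧ shadow ε γ ⊆ U := by
  by_contra! hcon
  let f := Set.Infinite.natEmbedding _ hx
  choose y hy hyU using fun n => not_subset.1 (hcon (f n) (f n).2)
  obtain ⟨φ, a, b, hφ, h⟩ := hd.exists_convergesTo (f := fun n => (f n : Γ))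
    (Subtype.val_injective.comp f.injective)
  obtain ⟨-, -, -, -, -, h1⟩ := h.exists_subseq_tendsto_of_mem_shadow hd hε (x := fun _ => x)
    fun n => (f (φ n)).2
  obtain rfl := tendsto_nhds_unique tendsto_const_nhds h1
  obtain ⟨ψ, -, -, -, -, h2⟩ := h.exists_subseq_tendsto_of_mem_shadow hd hε
    (x := fun n => y (φ n)) fun n => hy (φ n)
  obtain ⟨n, hn⟩ := (h2.eventually hU).exists
  exact hyU _ hn

/-- The inverses of the elements whose shadows contain `x` form the conical sequence: they send
every other point to `b`, while the images of `x` stay at distance at least `ε` from elements that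
tend to `b`. -/
theorem limsupShadow_subset (hd : IsCompactifying Γ) {ε : ℝ} (hε : 0 < ε) :
    limsupShadow Γ ε ⊆ uniformConicalLimitSet Γ ε ∩ conicalLimitSet Γ := by
  intro x hx
  let f := Set.Infinite.natEmbedding _ hx
  obtain ⟨φ, a, b, hφ, h⟩ := hd.exists_convergesTo (f := fun n => (f n : Γ))
    (Subtype.val_injective.comp f.injective)
  obtain ⟨ψ, u, hψ, hbu, hu, h1⟩ := h.exists_subseq_tendsto_of_mem_shadow hd hε (x := fun _ => x)
    fun n => (f (φ n)).2
  obtain rfl := tendsto_nhds_unique tendsto_const_nhds h1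
  have hlim : ∀ y, y ≠ x → Tendsto
      (fun n => (((f (φ (ψ n)) : Γ)⁻¹ : Γ) : M ≃ₜ M) y) atTop (𝓝 b) := fun y hy =>
    (h.subseq hψ).inv.tendsto_pt hd hy
  refine ⟨⟨b, u, _, hbu, hu, hlim⟩, ⟨b, _, h.convLocUnif hd⟩, u, b, _, ?_, hu, hlim⟩
  rintro rfl
  rw [dist_self] at hbu
  exact not_le.2 hε hbu

end

/-! ### Shadow lemma, divergence and Vitali covering. -/

section

theorem sum_measure_le_of_card_le {α ι : Type*} [MeasurableSpace α] (μ : Measure α)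
    (s : Finset ι) {A : ι → Set α} (hA : ∀ i, MeasurableSet (A i)) (n : ℕ)
    (h : ∀ x, {i ∈ (s : Set ι) | x ∈ A i}.ncard ≤ n) : ∑ i ∈ s, μ (A i) ≤ n * μ univ := by
  classical
  calc ∑ i ∈ s, μ (A i) = ∑ i ∈ s, ∫⁻ x, (A i).indicator 1 x ∂μ :=
        Finset.sum_congr rfl fun i _ => (lintegral_indicator_one (hA i)).symm
    _ = ∫⁻ x, ∑ i ∈ s, (A i).indicator 1 x ∂μ :=
        (lintegral_finsetSum _ fun i _ => measurable_one.indicator (hA i)).symm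
    _ ≤ ∫⁻ _, n ∂μ := by
        refine lintegral_mono fun x => ?_
        have h1 : ∑ i ∈ s, (A i).indicator (1 : α → ℝ≥0∞) x =
            ((s.filter fun i => x ∈ A i).card : ℝ≥0∞) := by
          simp [Set.indicator_apply, Finset.sum_boole]
        rw [h1]
        have h2 := h x
        rw [show {i ∈ (s : Set ι) | x ∈ A i} = ↑(s.filter fun i => x ∈ A i) by ext; simp,
          Set.ncard_coe_finset] at h2
        exact Nat.cast_le.2 h2
    _ = n * μ univ := lintegral_const _

variable {M : Type*} [TopologicalSpace M] {Γ : Subgroup (M ≃ₜ M)} {κ : ℝ} {σ : Γ → M → ℝ}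
  [MeasurableSpace M] {C δ : ℝ} {μ ν : Measure M}

/-- The part of the Patterson–Sullivan condition that bounds the measures of preimages of sets.
Unlike `IsPattersonSullivan`, it passes to restrictions to invariant sets by definition. -/
structure IsCoarselyConformal (Γ : Subgroup (M ≃ₜ M)) (σ : Γ → M → ℝ) (C δ : ℝ)
    (μ : Measure M) : Prop where
  le_preimage : ∀ (γ : Γ) (E : Set M) (s : ℝ), MeasurableSet E → (∀ x ∈ E, σ γ⁻¹ x ≤ s) →
    ENNReal.ofReal (Real.exp (-C - δ * s)) * μ E ≤ μ ((γ : M ≃ₜ M) ⁻¹' E)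
  preimage_le : ∀ (γ : Γ) (E : Set M) (s : ℝ), MeasurableSet E → (∀ x ∈ E, s ≤ σ γ⁻¹ x) →
    μ ((γ : M ≃ₜ M) ⁻¹' E) ≤ ENNReal.ofReal (Real.exp (C - δ * s)) * μ E
  preimage_null : ∀ (γ : Γ) (E : Set M), μ E = 0 → μ ((γ : M ≃ₜ M) ⁻¹' E) = 0

theorem IsPattersonSullivan.isCoarselyConformal [BorelSpace M]
    (h : IsPattersonSullivan Γ σ C δ μ) (hδ : 0 ≤ δ) : IsCoarselyConformal Γ σ C δ μ := by
  have := h.isProbability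
  have key : ∀ (γ : Γ) {E : Set M}, MeasurableSet E → μ ((γ : M ≃ₜ M) ⁻¹' E) =
      ∫⁻ x in E, (μ.map (γ : M ≃ₜ M)).rnDeriv μ x ∂μ := fun γ E hE => by
    rw [Measure.setLIntegral_rnDeriv (h.map_ac γ), Measure.map_apply (γ : M ≃ₜ M).measurable hE]
  refine ⟨fun γ E s hE hs => ?_, fun γ E s hE hs => ?_, fun γ E hE => ?_⟩
  · rw [key γ hE, ← setLIntegral_const]
    refine setLIntegral_mono_ae (Measure.measurable_rnDeriv _ _).aemeasurable ?_
    filter_upwards [h.rnDeriv_bounds γ] with x hx hxE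
    refine le_trans (ENNReal.ofReal_le_ofReal (Real.exp_le_exp.2 ?_)) hx.1
    linarith [mul_le_mul_of_nonneg_left (hs x hxE) hδ]
  · rw [key γ hE, ← setLIntegral_const]
    refine setLIntegral_mono_ae aemeasurable_const ?_
    filter_upwards [h.rnDeriv_bounds γ] with x hx hxE
    refine hx.2.trans (ENNReal.ofReal_le_ofReal (Real.exp_le_exp.2 ?_))
    linarith [mul_le_mul_of_nonneg_left (hs x hxE) hδ]
  · exact Measure.preimage_null_of_map_null (γ : M ≃ₜ M).measurable.aemeasurable (h.map_ac γ hE)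

namespace IsCoarselyConformal

theorem restrict [BorelSpace M] (h : IsCoarselyConformal Γ σ C δ μ) {A : Set M}
    (hA : MeasurableSet A) (hinv : ∀ γ : Γ, (γ : M ≃ₜ M) ⁻¹' A =ᵐ[μ] A) :
    IsCoarselyConformal Γ σ C δ (μ.restrict A) := by
  have key : ∀ (γ : Γ) (E : Set M), μ.restrict A ((γ : M ≃ₜ M) ⁻¹' E) =
      μ ((γ : M ≃ₜ M) ⁻¹' (E ∩ A)) := fun γ E => by
    rw [Measure.restrict_apply' hA, preimage_inter]
    exact measure_congr ((ae_eq_refl _).inter (hinv γ).symm)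
  refine ⟨fun γ E s hE hs => ?_, fun γ E s hE hs => ?_, fun γ E hE => ?_⟩
  · rw [key, Measure.restrict_apply' hA]
    exact h.le_preimage γ _ s (hE.inter hA) fun x hx => hs x hx.1
  · rw [key, Measure.restrict_apply' hA]
    exact h.preimage_le γ _ s (hE.inter hA) fun x hx => hs x hx.1
  · rw [key]
    rw [Measure.restrict_apply' hA] at hE
    exact h.preimage_null γ _ hE

variable [MetricSpace (Bord Γ)] {N : Γ → ℝ}

/-- The shadow lemma. -/
theorem exists_shadow_bounds (h : IsCoarselyConformal Γ σ C δ μ)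
    (hN : IsMagnitude Γ σ N) {ε : ℝ} (hε : 0 < ε) :
    ∃ K : ℝ≥0∞, K ≠ ∞ ∧ ∀ (γ : Γ) (E : Set M), MeasurableSet E →
      (∀ y ∈ E, ε ≤ dist (Bord.pt y : Bord Γ) (Bord.elt γ⁻¹)) →
      ENNReal.ofReal (Real.exp (-δ * N γ)) * μ E ≤ K * μ (((γ⁻¹ : Γ) : M ≃ₜ M) ⁻¹' E) ∧
      μ (((γ⁻¹ : Γ) : M ≃ₜ M) ⁻¹' E) ≤ K * (ENNReal.ofReal (Real.exp (-δ * N γ)) * μ E) := by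
  obtain ⟨c, -, hc⟩ := hN (ε / 2) (half_pos hε)
  refine ⟨ENNReal.ofReal (Real.exp (C + δ * c)), ENNReal.ofReal_ne_top, fun γ E hE hfar => ?_⟩
  have hb := fun y hy => hc y γ (lt_of_lt_of_le (half_lt_self hε) (hfar y hy))
  have h1 := h.le_preimage γ⁻¹ E (N γ + c) hE fun y hy => by rw [inv_inv]; exact (hb y hy).2
  have h2 := h.preimage_le γ⁻¹ E (N γ - c) hE fun y hy => by rw [inv_inv]; exact (hb y hy).1
  constructor
  · refine le_trans (le_of_eq ?_) (mul_le_mul_right h1 _)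
    rw [← mul_assoc, ← ENNReal.ofReal_mul (Real.exp_nonneg _), ← Real.exp_add]
    congr 3
    ring
  · refine h2.trans (le_of_eq ?_)
    rw [← mul_assoc, ← ENNReal.ofReal_mul (Real.exp_nonneg _), ← Real.exp_add]
    congr 3
    ring

variable [CompactSpace M] [TopologicalSpace.MetrizableSpace M]

/-- Otherwise, by compactness, `μ` is carried by a single point of `Bord Γ`. A point of `Γ` carries
no mass, and a point of `M` carrying everything would be moved by some `g`, against
quasi-invariance. -/
theorem exists_le_measure_compl_ball (h : IsCoarselyConformal Γ σ C δ μ) [IsFiniteMeasure μ]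
    (hμ : μ ≠ 0) (hd : IsCompactifying Γ) (hne : IsNonElementary Γ) :
    ∃ ε > 0, ∃ c ≠ 0, ∀ γ : Γ, c ≤ μ {y | ε ≤ dist (Bord.pt y : Bord Γ) (Bord.elt γ)} := by
  by_contra! hcon
  have := hd.compact
  choose γ hγ using fun n : ℕ => hcon (1 / ((n : ℝ) + 1)) (by positivity)
    ((n : ℝ≥0∞)⁻¹) (by simp)
  obtain ⟨p, -, φ, hφ, hp⟩ := isCompact_univ.tendsto_subseq
    (x := fun n => (Bord.elt (γ n) : Bord Γ)) fun _ => mem_univ _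
  have hball : ∀ r > 0, μ {y | r ≤ dist (Bord.pt y : Bord Γ) p} = 0 := by
    intro r hr
    refine le_antisymm (ge_of_tendsto
      (ENNReal.tendsto_inv_nat_nhds_zero.comp hφ.tendsto_atTop) ?_) zero_le
    have h1 := hp.eventually (Metric.ball_mem_nhds p (half_pos hr))
    have h2 := (tendsto_one_div_add_atTop_nhds_zero_nat (𝕜 := ℝ)).comp hφ.tendsto_atTop
      |>.eventually_lt_const (half_pos hr)
    filter_upwards [h1, h2] with n h1 h2
    refine (measure_mono fun y (hy : r ≤ _) => ?_).trans (hγ (φ n)).le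
    have h1 : dist (Bord.elt (γ (φ n)) : Bord Γ) p < r / 2 := h1
    have h2 : 1 / ((φ n : ℝ) + 1) < r / 2 := h2
    have := dist_triangle (Bord.pt y : Bord Γ) (Bord.elt (γ (φ n))) p
    change 1 / ((φ n : ℝ) + 1) ≤ dist (Bord.pt y : Bord Γ) (Bord.elt (γ (φ n)))
    linarith
  have hcompl : μ {y | (Bord.pt y : Bord Γ) ≠ p} = 0 := by
    refine measure_mono_null (t := ⋃ n : ℕ, {y | 1 / ((n : ℝ) + 1) ≤ dist (Bord.pt y : Bord Γ) p})
      (fun y hy => ?_) (measure_iUnion_null fun n => hball _ (by positivity))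
    obtain ⟨n, hn⟩ := exists_nat_one_div_lt (dist_pos.2 hy)
    exact mem_iUnion.2 ⟨n, hn.le⟩
  apply hμ
  rw [← Measure.measure_univ_eq_zero]
  cases p with
  | elt g => exact measure_mono_null (fun y _ => by simp) hcompl
  | pt z =>
    obtain ⟨g, hg⟩ := hd.exists_apply_ne hne z
    refine measure_mono_null (fun y _ => ?_) (measure_union_null hcompl (h.preimage_null g _ hcompl))
    by_cases hy : y = z
    · subst hy
      exact Or.inr (by simpa using hg)
    · exact Or.inl (by simpa using hy)

variable [BorelSpace M]

/-- If the limsup set is null, outside small measure a point lies only in shadows of magnitude at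
most `R`. Images of that good set under group elements have bounded multiplicity, so integrating the
multiplicity bounds the divergent Poincaré series. -/
theorem exists_measure_limsupShadow_ne_zero (h : IsCoarselyConformal Γ σ C δ μ)
    [IsFiniteMeasure μ] (hμ : μ ≠ 0) (hd : IsCompactifying Γ) (hne : IsNonElementary Γ)
    (hσ : IsCoarseCocycle Γ κ σ) (hN : IsMagnitude Γ σ N) (hNt : Tendsto N cofinite atTop)
    (hdiv : poincareSeries N δ = ∞) : ∃ ε > 0, μ (limsupShadow Γ ε) ≠ 0 := by
  have := hd.countable
  obtain ⟨ε, hε, c, hc, hball⟩ := h.exists_le_measure_compl_ball hμ hd hne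
  obtain ⟨ε', hε', hdist⟩ := hN.exists_le_dist_of_mem_shadow hd hσ hNt hε 0
  obtain ⟨K, hK, hbd⟩ := h.exists_shadow_bounds hN hε
  refine ⟨ε', hε', fun hnull => ?_⟩
  let D : ℕ → Set M := fun R => {x | ∀ γ : Γ, x ∈ shadow ε' γ → N γ ≤ R}
  have hD : ∀ R, MeasurableSet (D R) := fun R => by
    simp only [D, ofPred_forall]
    refine .iInter fun γ => ?_
    by_cases hR : N γ ≤ R
    · simp [hR]
    · refine (isClosed_shadow hd ε' γ).measurableSet.compl.congr ?_
      ext x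
      simp [hR]
  have hDlim : Tendsto (μ ∘ fun R => (D R)ᶜ) atTop (𝓝 0) := by
    have := tendsto_measure_iInter_atTop (μ := μ) (s := fun R => (D R)ᶜ)
      (fun R => (hD R).compl.nullMeasurableSet)
      (fun R R' hR => compl_subset_compl.2 fun x hx γ hγ =>
        (hx γ hγ).trans (Nat.cast_le.2 hR)) ⟨0, measure_ne_top _ _⟩
    rwa [measure_mono_null (t := limsupShadow Γ ε') ?_ hnull] at this
    intro x hx
    by_contra hfin
    obtain ⟨B, hB⟩ := ((not_infinite.1 hfin).image N).bddAbove
    obtain ⟨R, hR⟩ := exists_nat_ge B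
    exact mem_iInter.1 hx R fun γ hγ => (hB (mem_image_of_mem N hγ)).trans hR
  -- With bad set of mass below `c / 2`, at least `c / 2` of each ball complement remains in `D R`.
  obtain ⟨R, hR⟩ := (hDlim.eventually_lt_const (ENNReal.half_pos hc)).exists
  let A : Γ → Set M := fun γ =>
    ((γ⁻¹ : Γ) : M ≃ₜ M) ⁻¹' ({y | ε ≤ dist (Bord.pt y : Bord Γ) (Bord.elt γ⁻¹)} ∩ D R)
  have hFm : ∀ γ : Γ, MeasurableSet
      ({y : M | ε ≤ dist (Bord.pt y : Bord Γ) (Bord.elt γ⁻¹)} ∩ D R) := fun γ =>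
    (measurableSet_compl_ball hd ε _).inter (hD R)
  have hA : ∀ γ, MeasurableSet (A γ) := fun γ => ((γ⁻¹ : Γ) : M ≃ₜ M).measurable (hFm γ)
  have hlow : ∀ γ : Γ, ENNReal.ofReal (Real.exp (-δ * N γ)) * (c / 2) ≤ K * μ (A γ) := by
    intro γ
    refine le_trans (mul_le_mul_right ?_ _) (hbd γ _ (hFm γ) fun y hy => hy.1).1
    by_contra! hlt
    refine not_lt.2 (hball γ⁻¹) ?_
    rw [← ENNReal.add_halves c]
    refine lt_of_le_of_lt ?_ (ENNReal.add_lt_add hlt hR)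
    exact (measure_mono fun y hy => (em (y ∈ D R)).imp (fun h => ⟨hy, h⟩) id).trans
      (measure_union_le _ _)
  have hfin : {γ : Γ | N γ ≤ R}.Finite := by
    simpa [Set.Finite, not_lt] using hNt.eventually (eventually_gt_atTop (R : ℝ))
  have hcard : ∀ (s : Finset Γ) (x : M), {γ ∈ (s : Set Γ) | x ∈ A γ}.ncard ≤
      {γ : Γ | N γ ≤ R}.ncard := by
    intro s x
    rcases eq_empty_or_nonempty {γ ∈ (s : Set Γ) | x ∈ A γ} with he | hn
    · rw [he, ncard_empty]
      exact Nat.zero_le _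
    · have hsf : {γ ∈ (s : Set Γ) | x ∈ A γ}.Finite := s.finite_toSet.subset (sep_subset _ _)
      -- Relative to the element of least magnitude, `γ₀⁻¹ x` lies in `D R` and in the `ε'`-shadow
      -- of `γ₀⁻¹ * γ`, so only finitely many `γ₀⁻¹ * γ` are possible.
      obtain ⟨γ₀, hγ₀, hmin⟩ := hsf.exists_minimalFor N _ hn
      have hmin' : ∀ γ ∈ {γ ∈ (s : Set Γ) | x ∈ A γ}, N γ₀ ≤ N γ := fun γ hγ =>
        (le_total (N γ₀) (N γ)).elim id fun hle => hmin hγ hle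
      refine ncard_le_ncard_of_injOn (fun γ => γ₀⁻¹ * γ) (fun γ hγ => ?_)
        (mul_right_injective γ₀⁻¹).injOn hfin
      have h1 := hdist γ₀ γ x (by simpa using hmin' γ hγ) hγ₀.2.1 hγ.2.1
      refine hγ₀.2.2 (γ₀⁻¹ * γ) ?_
      simp only [shadow, mem_ofPred_eq, mul_inv_rev, inv_inv]
      refine h1.trans_eq ?_
      congr 2
      change _ = ((γ⁻¹ * γ₀ * γ₀⁻¹ : Γ) : M ≃ₜ M) x
      rw [mul_inv_cancel_right]
  have hsum : poincareSeries N δ * (c / 2) ≤ K * ({γ : Γ | N γ ≤ R}.ncard * μ univ) := by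
    rw [poincareSeries, ← ENNReal.tsum_mul_right, ENNReal.tsum_eq_iSup_sum]
    refine iSup_le fun s => (Finset.sum_le_sum fun γ _ => hlow γ).trans ?_
    rw [← Finset.mul_sum]
    exact mul_le_mul_right (sum_measure_le_of_card_le μ s hA _ (hcard s)) _
  rw [hdiv, ENNReal.top_mul (ENNReal.half_pos hc).ne', top_le_iff] at hsum
  exact ENNReal.mul_ne_top hK (ENNReal.mul_ne_top (ENNReal.natCast_ne_top _)
    (measure_ne_top _ _)) hsum

/-- Cover the set by shadows inside an open `U ⊇ E` and extract a disjoint family whose enlargements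
still cover. Both measures see a shadow as `exp (-δ * N γ)`, so the `μ`-mass is at most a constant
times `ν U`, and `U` can be taken with small `ν`-mass. -/
theorem measure_inter_limsupShadow_eq_zero (hμ : IsCoarselyConformal Γ σ C δ μ)
    (hν : IsCoarselyConformal Γ σ C δ ν) [IsFiniteMeasure μ] [IsFiniteMeasure ν]
    (hd : IsCompactifying Γ) (hσ : IsCoarseCocycle Γ κ σ) (hN : IsMagnitude Γ σ N)
    (hNt : Tendsto N cofinite atTop) {ε : ℝ} (hε : 0 < ε) {c : ℝ≥0∞} (hc : c ≠ 0)
    (hball : ∀ γ : Γ, c ≤ ν {y | ε ≤ dist (Bord.pt y : Bord Γ) (Bord.elt γ)}) {E : Set M}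
    (hE : ν E = 0) : μ (E ∩ limsupShadow Γ ε) = 0 := by
  have := hd.countable
  -- The Vitali selection below uses sizes `exp (-N γ)` with ratio `2`, hence the slack `log 2` in
  -- magnitude.
  obtain ⟨ε', hε', hsub⟩ := hN.exists_shadow_subset_shadow hd hσ hNt hε (Real.log 2)
  obtain ⟨K₁, hK₁, hb₁⟩ := hν.exists_shadow_bounds hN hε
  obtain ⟨K₂, hK₂, hb₂⟩ := hμ.exists_shadow_bounds hN hε'
  have hct : c ≠ ∞ := ne_top_of_le_ne_top (measure_ne_top _ _) (hball 1)
  set K := K₂ * (μ univ * (K₁ / c)) with hKdef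
  have hK : K ≠ ∞ := ENNReal.mul_ne_top hK₂
    (ENNReal.mul_ne_top (measure_ne_top _ _) (ENNReal.div_ne_top hK₁ hc))
  have hcomp : ∀ γ : Γ, μ (shadow ε' γ) ≤ K * ν (shadow ε γ) := by
    intro γ
    have h1 := (hb₁ γ _ (measurableSet_compl_ball hd ε _) fun y hy => hy).1
    have h2 := (hb₂ γ _ (measurableSet_compl_ball hd ε' _) fun y hy => hy).2
    rw [← shadow_eq_preimage] at h1 h2
    have h3 : ENNReal.ofReal (Real.exp (-δ * N γ)) ≤ K₁ / c * ν (shadow ε γ) := by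
      rw [ENNReal.div_eq_inv_mul, mul_assoc, ← ENNReal.div_eq_inv_mul,
        ENNReal.le_div_iff_mul_le (Or.inl hc) (Or.inl hct)]
      exact (mul_le_mul_right (hball γ⁻¹) _).trans h1
    calc μ (shadow ε' γ) ≤ K₂ * (ENNReal.ofReal (Real.exp (-δ * N γ)) * μ univ) :=
          h2.trans (mul_le_mul_right (mul_le_mul_right (measure_mono (subset_univ _)) _) _)
      _ ≤ K₂ * (K₁ / c * ν (shadow ε γ) * μ univ) :=
          mul_le_mul_right (mul_le_mul_left h3 _) _
      _ = K * ν (shadow ε γ) := by rw [hKdef]; ring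
  have hopen : ∀ U, IsOpen U → E ⊆ U → μ (E ∩ limsupShadow Γ ε) ≤ K * ν U := by
    intro U hU hEU
    obtain ⟨B, hB⟩ : ∃ B, ∀ γ : Γ, B ≤ N γ := by
      rcases isEmpty_or_nonempty Γ with he | hn
      · exact ⟨0, fun γ => he.elim γ⟩
      · obtain ⟨γ₀, h0⟩ := hNt.exists_forall_le
        exact ⟨_, h0⟩
    obtain ⟨u, hut, hdisj, hcov⟩ := Vitali.exists_disjoint_subfamily_covering_enlargement
      (fun γ : Γ => (shadow ε γ : Set M)) {γ | (shadow ε γ : Set M).Nonempty ∧ shadow ε γ ⊆ U}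
      (fun γ => Real.exp (-N γ)) 2 one_lt_two (fun _ _ => Real.exp_nonneg _) (Real.exp (-B))
      (fun γ _ => Real.exp_le_exp.2 (neg_le_neg (hB γ))) fun γ hγ => hγ.1
    have hcover : E ∩ limsupShadow Γ ε ⊆ ⋃ γ ∈ u, shadow ε' γ := by
      rintro x ⟨hxE, hxL⟩
      obtain ⟨γ, hxγ, hγU⟩ := exists_shadow_subset_of_mem_limsupShadow hd hε hxL
        (hU.mem_nhds (hEU hxE))
      obtain ⟨η, hη, hmeet, hle⟩ := hcov γ ⟨⟨x, hxγ⟩, hγU⟩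
      refine mem_biUnion hη (hsub η γ ?_ (by rwa [inter_comm]) hxγ)
      have := Real.log_le_log (Real.exp_pos _) hle
      rw [Real.log_mul two_ne_zero (Real.exp_pos _).ne', Real.log_exp, Real.log_exp] at this
      linarith
    calc μ (E ∩ limsupShadow Γ ε) ≤ μ (⋃ γ ∈ u, shadow ε' γ) := measure_mono hcover
      _ ≤ ∑' γ : u, μ (shadow ε' (γ : Γ)) := measure_biUnion_le _ u.to_countable _
      _ ≤ ∑' γ : u, K * ν (shadow ε (γ : Γ)) := ENNReal.tsum_le_tsum fun γ => hcomp γ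
      _ = K * ν (⋃ γ ∈ u, shadow ε γ) := by
          rw [ENNReal.tsum_mul_left, measure_biUnion u.to_countable hdisj
            fun γ _ => (isClosed_shadow hd ε γ).measurableSet]
      _ ≤ K * ν U := mul_le_mul_right (measure_mono (iUnion₂_subset fun γ hγ => (hut hγ).2)) _
  refine le_antisymm (ENNReal.le_of_forall_pos_le_add fun r hr _ => ?_) zero_le
  have hrK : (0 : ℝ≥0∞) < r / (K + 1) := ENNReal.div_pos (by exact_mod_cast hr.ne')
    (ENNReal.add_ne_top.2 ⟨hK, ENNReal.one_ne_top⟩)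
  obtain ⟨U, hEU, hU, hνU⟩ := E.exists_isOpen_lt_of_lt (μ := ν) (r / (K + 1)) (hE ▸ hrK)
  rw [zero_add]
  calc μ (E ∩ limsupShadow Γ ε) ≤ K * ν U := hopen U hU hEU
    _ ≤ (K + 1) * (r / (K + 1)) := mul_le_mul' le_self_add hνU.le
    _ ≤ r := ENNReal.mul_div_le

end IsCoarselyConformal

end

/-! ### Full measure, absolute continuity and ergodicity. -/

section

section

variable {M : Type*} [TopologicalSpace M] {Γ : Subgroup (M ≃ₜ M)}

theorem apply_mem_conicalLimitSet {x : M} (g : Γ)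
    (hx : (g : M ≃ₜ M) x ∈ conicalLimitSet Γ) : x ∈ conicalLimitSet Γ := by
  obtain ⟨⟨y, η, hη⟩, a, b, γ, hab, ha, hb⟩ := hx
  refine ⟨⟨y, fun n => g⁻¹ * η n, fun V hV z hz => ?_⟩, a, b, fun n => γ n * g, hab, ha,
    fun y hy => hb _ ((g : M ≃ₜ M).injective.ne hy)⟩
  refine hη _ (((g⁻¹ : Γ) : M ≃ₜ M).continuous.continuousAt.preimage_mem_nhds ?_) z hz
  rwa [show ((g⁻¹ : Γ) : M ≃ₜ M) ((g : M ≃ₜ M) x) = x from (g : M ≃ₜ M).symm_apply_apply x]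

/-- The union of all translates of a set. -/
def saturation (Γ : Subgroup (M ≃ₜ M)) (E : Set M) : Set M := ⋃ g : Γ, (g : M ≃ₜ M) ⁻¹' E

theorem subset_saturation (E : Set M) : E ⊆ saturation Γ E := fun _ hx =>
  mem_iUnion.2 ⟨1, hx⟩

theorem preimage_saturation (g : Γ) (E : Set M) :
    (g : M ≃ₜ M) ⁻¹' saturation Γ E = saturation Γ E := by
  ext x
  simp only [saturation, mem_preimage, mem_iUnion]
  refine ⟨fun ⟨h, hx⟩ => ⟨h * g, hx⟩, fun ⟨h, hx⟩ => ⟨h * g⁻¹, ?_⟩⟩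
  change (h : M ≃ₜ M) (((g⁻¹ * g : Γ) : M ≃ₜ M) x) ∈ E
  rwa [inv_mul_cancel]

theorem measurableSet_saturation [MeasurableSpace M] [BorelSpace M] [Countable Γ] {E : Set M}
    (hE : MeasurableSet E) : MeasurableSet (saturation Γ E) :=
  .iUnion fun g => (g : M ≃ₜ M).measurable hE

theorem ActsErgodically.measure_compl_saturation [MeasurableSpace M] [BorelSpace M] [Countable Γ]
    {μ : Measure M} (h : ActsErgodically Γ μ) {E : Set M} (hE : MeasurableSet E) (h0 : μ E ≠ 0) :
    μ (saturation Γ E)ᶜ = 0 :=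
  (h _ (measurableSet_saturation hE) fun g => (preimage_saturation g E).eventuallyEq).resolve_left
    fun h1 => h0 (measure_mono_null (subset_saturation E) h1)

end

variable {M : Type*} [TopologicalSpace M] {Γ : Subgroup (M ≃ₜ M)} {κ : ℝ} {σ : Γ → M → ℝ}
  [MeasurableSpace M] [BorelSpace M] {C δ : ℝ} {μ ν : Measure M}

/-- Two Patterson–Sullivan measures of the same dimension, one of which is ergodic and dominates
the other, are comparable. -/
theorem IsPattersonSullivan.le_smul [Countable Γ] (hμ : IsPattersonSullivan Γ σ C δ μ)
    (hν : IsPattersonSullivan Γ σ C δ ν) (hac : μ ≪ ν) (herg : ActsErgodically Γ ν) :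
    μ ≤ ENNReal.ofReal (Real.exp (2 * C)) • ν := by
  have := hμ.isProbability
  have := hν.isProbability
  set f := μ.rnDeriv ν
  have hf : Measurable f := Measure.measurable_rnDeriv μ ν
  have hfν : ν.withDensity f = μ := Measure.withDensity_rnDeriv_eq _ _ hac
  have hquasi : ∀ (γ : Γ) {p : M → Prop}, (∀ᵐ x ∂ν, p x) → ∀ᵐ x ∂ν, p ((γ : M ≃ₜ M) x) :=
    fun γ p hp => Measure.preimage_null_of_map_null (γ : M ≃ₜ M).measurable.aemeasurable
      (hν.map_ac γ hp)
  -- The chain rule writes the density of `γ⁻¹_* μ` with respect to `ν` through `μ` and through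
  -- `γ⁻¹_* ν`. The cocycle factors cancel and leave `exp (2 * C)`.
  have hP : ∀ γ : Γ, ∀ᵐ x ∂ν,
      f ((γ : M ≃ₜ M) x) ≤ ENNReal.ofReal (Real.exp (2 * C)) * f x := by
    intro γ
    set T : M ≃ₜ M := ((γ⁻¹ : Γ) : M ≃ₜ M)
    have h1 := Measure.rnDeriv_mul_rnDeriv (κ := ν) (hμ.map_ac γ⁻¹)
    have h2 := Measure.rnDeriv_mul_rnDeriv (κ := ν) (hac.map T.measurable)
    have h3 := hquasi γ (T.measurableEmbedding.rnDeriv_map μ ν)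
    have h4 := hμ.rnDeriv_bounds γ⁻¹
    -- The bound for `μ` holds `μ`-almost everywhere, so in terms of `ν` it is available only where
    -- `f` does not vanish.
    rw [← hfν, ae_withDensity_iff hf, hfν] at h4
    filter_upwards [h1, h2, h3, h4, hν.rnDeriv_bounds γ⁻¹] with x e1 e2 e3 e4 e5
    rw [show T ((γ : M ≃ₜ M) x) = x from (γ : M ≃ₜ M).symm_apply_apply x] at e3
    simp only [Pi.mul_apply] at e1 e2
    rw [inv_inv] at e4 e5
    have e6 : f ((γ : M ≃ₜ M) x) * ENNReal.ofReal (Real.exp (-C - δ * σ γ x)) ≤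
        ENNReal.ofReal (Real.exp (C - δ * σ γ x)) * f x := by
      calc f ((γ : M ≃ₜ M) x) * ENNReal.ofReal (Real.exp (-C - δ * σ γ x))
          ≤ f ((γ : M ≃ₜ M) x) * (ν.map T).rnDeriv ν x := mul_le_mul_right e5.1 _
        _ = (μ.map T).rnDeriv μ x * f x := by
            rw [show f ((γ : M ≃ₜ M) x) = _ from e3.symm]
            exact e2.trans e1.symm
        _ ≤ _ := by
            by_cases h0 : f x = 0
            · simp [h0]
            · exact mul_le_mul_left (e4 h0).2 _
    have hexp : ∀ a b : ℝ, ENNReal.ofReal (Real.exp a) * ENNReal.ofReal (Real.exp b) =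
        ENNReal.ofReal (Real.exp (a + b)) := fun a b => by
      rw [← ENNReal.ofReal_mul (Real.exp_nonneg _), ← Real.exp_add]
    calc f ((γ : M ≃ₜ M) x) = f ((γ : M ≃ₜ M) x) *
          ENNReal.ofReal (Real.exp (-C - δ * σ γ x)) *
          ENNReal.ofReal (Real.exp (C + δ * σ γ x)) := by
            rw [mul_assoc, hexp, show -C - δ * σ γ x + (C + δ * σ γ x) = 0 by ring]
            simp
      _ ≤ ENNReal.ofReal (Real.exp (C - δ * σ γ x)) * f x *
          ENNReal.ofReal (Real.exp (C + δ * σ γ x)) := mul_le_mul_left e6 _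
      _ = ENNReal.ofReal (Real.exp (2 * C)) * f x := by
            rw [mul_right_comm, hexp]
            congr 3
            ring
  have hK : ENNReal.ofReal (Real.exp (2 * C)) ≠ 0 := by simp [Real.exp_pos]
  have hle : ∀ᵐ x ∂ν, f x ≤ ENNReal.ofReal (Real.exp (2 * C)) := by
    by_contra hcon
    have hE : MeasurableSet {x | ENNReal.ofReal (Real.exp (2 * C)) < f x} :=
      measurableSet_lt measurable_const hf
    -- Almost every orbit enters `{f > exp (2 * C)}`, so quasi-invariance of `f` gives `f > 1`
    -- almost everywhere, contradicting total mass one.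
    have hsat := herg.measure_compl_saturation hE (by simpa [ae_iff] using hcon)
    have hlt : ∀ᵐ x ∂ν, 1 < f x := by
      filter_upwards [ae_all_iff.2 hP, compl_mem_ae_iff.2 hsat] with x hx hxs
      rw [compl_compl] at hxs
      obtain ⟨g, hg⟩ := mem_iUnion.1 hxs
      by_contra! h1
      exact not_lt.2 ((hx g).trans (mul_le_of_le_one_right' h1)) hg
    have h1 := lintegral_strict_mono (IsProbabilityMeasure.ne_zero ν) hf.aemeasurable
      (f := fun _ => 1) (by simp) hlt
    rw [← setLIntegral_univ f, Measure.setLIntegral_rnDeriv hac] at h1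
    simp at h1
  refine Measure.le_iff.2 fun s _ => ?_
  rw [← Measure.setLIntegral_rnDeriv hac, Measure.smul_apply, smul_eq_mul, ← setLIntegral_const]
  exact lintegral_mono_ae (ae_restrict_of_ae hle)

namespace IsCoarselyConformal

variable [MetricSpace (Bord Γ)] {N : Γ → ℝ} [CompactSpace M] [TopologicalSpace.MetrizableSpace M]

/-- Saturating makes the set exactly invariant. The restriction of `μ` to its complement is again
coarsely conformal but gives no mass to any limsup of shadows, so it must vanish. -/
theorem measure_compl_saturation_limsupShadow (h : IsCoarselyConformal Γ σ C δ μ)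
    [IsFiniteMeasure μ] (hd : IsCompactifying Γ) (hne : IsNonElementary Γ)
    (hσ : IsCoarseCocycle Γ κ σ) (hN : IsMagnitude Γ σ N) (hNt : Tendsto N cofinite atTop)
    (hdiv : poincareSeries N δ = ∞) :
    μ (saturation Γ (⋃ n : ℕ, limsupShadow Γ (1 / ((n : ℝ) + 1))))ᶜ = 0 := by
  have := hd.countable
  set S := saturation Γ (⋃ n : ℕ, limsupShadow Γ (1 / ((n : ℝ) + 1)))
  have hS : MeasurableSet S :=
    measurableSet_saturation (.iUnion fun n => measurableSet_limsupShadow hd _)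
  by_contra h0
  obtain ⟨ε, hε, hpos⟩ := (h.restrict hS.compl fun g =>
    (congrArg compl (preimage_saturation g _)).eventuallyEq).exists_measure_limsupShadow_ne_zero
    (fun e => h0 (Measure.restrict_eq_zero.1 e)) hd hne hσ hN hNt hdiv
  apply hpos
  obtain ⟨n, hn⟩ := exists_nat_one_div_lt hε
  rw [Measure.restrict_apply' hS.compl]
  refine measure_mono_null (t := ∅) ?_ measure_empty
  rintro x ⟨hx, hxS⟩
  refine hxS (subset_saturation _ (mem_iUnion.2 ⟨n, ?_⟩))
  exact Set.Infinite.mono (fun γ hγ => shadow_anti hn.le γ hγ) hx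

theorem absolutelyContinuous (hμ : IsCoarselyConformal Γ σ C δ μ)
    (hν : IsCoarselyConformal Γ σ C δ ν) [IsFiniteMeasure μ] [IsFiniteMeasure ν]
    (hν0 : ν ≠ 0) (hd : IsCompactifying Γ) (hne : IsNonElementary Γ)
    (hσ : IsCoarseCocycle Γ κ σ) (hN : IsMagnitude Γ σ N) (hNt : Tendsto N cofinite atTop)
    (hdiv : poincareSeries N δ = ∞) : μ ≪ ν := by
  have := hd.countable
  intro E hE
  obtain ⟨ε, hε, c, hc, hball⟩ := hν.exists_le_measure_compl_ball hν0 hd hne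
  have hsmall : ∀ F : Set M, ν F = 0 → ∀ n : ℕ,
      μ (F ∩ limsupShadow Γ (1 / ((n : ℝ) + 1))) = 0 := by
    intro F hF n
    -- The scale must also be at most `ε`, where `ν` has uniform mass off balls; shrinking it only
    -- enlarges the limsup set.
    have hmin : 0 < min ε (1 / ((n : ℝ) + 1)) := lt_min hε (by positivity)
    refine measure_mono_null (inter_subset_inter_right F fun x hx => ?_)
      (hμ.measure_inter_limsupShadow_eq_zero hν hd hσ hN hNt hmin hc (fun γ =>
        (hball γ).trans (measure_mono fun y (hy : ε ≤ _) => (min_le_left ε _).trans hy)) hF)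
    exact Set.Infinite.mono (fun γ hγ => shadow_anti (min_le_right _ _) γ hγ) hx
  refine measure_mono_null (t := (saturation Γ (⋃ n : ℕ, limsupShadow Γ (1 / ((n : ℝ) + 1))))ᶜ ∪
    ⋃ g : Γ, (g : M ≃ₜ M) ⁻¹' ⋃ n : ℕ, (((g⁻¹ : Γ) : M ≃ₜ M) ⁻¹' E) ∩
      limsupShadow Γ (1 / ((n : ℝ) + 1))) (fun x hx => ?_) (measure_union_null
      (hμ.measure_compl_saturation_limsupShadow hd hne hσ hN hNt hdiv)
      (measure_iUnion_null fun g => hμ.preimage_null g _ (measure_iUnion_null fun n =>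
        hsmall _ (hν.preimage_null g⁻¹ E hE) n)))
  refine (em _).symm.imp id fun hxS => ?_
  obtain ⟨g, hg⟩ := mem_iUnion.1 hxS
  obtain ⟨n, hn⟩ := mem_iUnion.1 hg
  refine mem_iUnion.2 ⟨g, mem_iUnion.2 ⟨n, ?_, hn⟩⟩
  rw [mem_preimage, show ((g⁻¹ : Γ) : M ≃ₜ M) ((g : M ≃ₜ M) x) = x from
    (g : M ≃ₜ M).symm_apply_apply x]
  exact hx

/-- The restrictions to an invariant set and to its complement are both coarsely conformal. If both
were nonzero, one would be absolutely continuous with respect to the other, although they are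
mutually singular. -/
theorem actsErgodically (hμ : IsCoarselyConformal Γ σ C δ μ) [IsFiniteMeasure μ]
    (hd : IsCompactifying Γ) (hne : IsNonElementary Γ)
    (hσ : IsCoarseCocycle Γ κ σ) (hN : IsMagnitude Γ σ N) (hNt : Tendsto N cofinite atTop)
    (hdiv : poincareSeries N δ = ∞) : ActsErgodically Γ μ := by
  intro A hA hinv
  by_contra! hcon
  have hAc : ∀ γ : Γ, (γ : M ≃ₜ M) ⁻¹' Aᶜ =ᵐ[μ] (Aᶜ : Set M) := fun γ => by
    rw [preimage_compl]
    exact (hinv γ).compl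
  have hac := (hμ.restrict hA hinv).absolutelyContinuous (hμ.restrict hA.compl hAc)
    (fun e => hcon.2 (Measure.restrict_eq_zero.1 e)) hd hne hσ hN hNt hdiv
  have h0 : μ.restrict Aᶜ A = 0 := by
    rw [Measure.restrict_apply hA, inter_compl_self, measure_empty]
  have h1 := hac h0
  rw [Measure.restrict_apply_self] at h1
  exact hcon.1 h1

end IsCoarselyConformal

end

end ConvGroup

/-! ### The three conclusions. -/

theorem theorem1p4 {M : Type*} [TopologicalSpace M] [CompactSpace M]
    [TopologicalSpace.MetrizableSpace M] [MeasurableSpace M] [BorelSpace M]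
    (Γ : Subgroup (M ≃ₜ M)) (hΓ : IsConvergenceGroup Γ) (hne : IsNonElementary Γ)
    [MetricSpace (Bord Γ)] (hd : IsCompactifying Γ)
    (κ : ℝ) (σ : Γ → M → ℝ) (hσ : IsCoarseCocycle Γ κ σ) (hexp : IsExpanding Γ σ)
    (N : Γ → ℝ) (hN : IsMagnitude Γ σ N)
    (δ : ℝ≥0) (hδ : criticalExponent N = δ) (hdiv : poincareSeries N δ = ∞)
    (C : ℝ) (μ : Measure M) (hμ : IsPattersonSullivan Γ σ C δ μ) :
    ActsErgodically Γ μ ∧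
    (∀ ν : Measure M, IsPattersonSullivan Γ σ C δ ν →
      ENNReal.ofReal (Real.exp (-4 * C)) • μ ≤ ν ∧
      ν ≤ ENNReal.ofReal (Real.exp (4 * C)) • μ) ∧
    (∀ᵐ x ∂μ, x ∈ conicalLimitSet Γ) ∧
    (∃ ε₀ > 0, ∀ ε, 0 < ε → ε ≤ ε₀ → ∀ᵐ x ∂μ, x ∈ uniformConicalLimitSet Γ ε) := by
  have := hd.countable
  have := hμ.isProbability
  have hNt := hN.tendsto_cofinite hd hne hσ hexp.1
  have hcμ := hμ.isCoarselyConformal δ.2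
  have herg := hcμ.actsErgodically hd hne hσ hN hNt hdiv
  refine ⟨herg, fun ν hν => ?_, ?_, ?_⟩
  · have := hν.isProbability
    have hcν := hν.isCoarselyConformal δ.2
    have h1 := hμ.le_smul hν (hcμ.absolutelyContinuous hcν (IsProbabilityMeasure.ne_zero ν)
      hd hne hσ hN hNt hdiv) (hcν.actsErgodically hd hne hσ hN hNt hdiv)
    have h2 := hν.le_smul hμ (hcν.absolutelyContinuous hcμ (IsProbabilityMeasure.ne_zero μ)
      hd hne hσ hN hNt hdiv) herg
    -- The comparison above has constant `exp (2 * C)`; weakening it to `exp (4 * C)` needs `C ≥ 0`,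
    -- which the consistency of the two density bounds forces.
    have hC : 0 ≤ C := by
      obtain ⟨x, hx⟩ := (hμ.rnDeriv_bounds 1).exists
      have := (ENNReal.ofReal_le_ofReal_iff (Real.exp_nonneg _)).1 (hx.1.trans hx.2)
      linarith [Real.exp_le_exp.1 this]
    constructor
    · refine Measure.le_iff'.2 fun s => ?_
      have h3 := Measure.le_iff'.1 h1 s
      rw [Measure.smul_apply, smul_eq_mul] at h3 ⊢
      refine (mul_le_mul_right h3 _).trans ?_
      rw [← mul_assoc, ← ENNReal.ofReal_mul (Real.exp_nonneg _), ← Real.exp_add]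
      refine mul_le_of_le_one_left' (ENNReal.ofReal_le_one.2 (Real.exp_le_one_iff.2 ?_))
      linarith
    · refine h2.trans (Measure.le_iff'.2 fun s => ?_)
      rw [Measure.smul_apply, Measure.smul_apply, smul_eq_mul, smul_eq_mul]
      refine mul_le_mul_left (ENNReal.ofReal_le_ofReal (Real.exp_le_exp.2 ?_)) _
      linarith
  · have h0 := hcμ.measure_compl_saturation_limsupShadow hd hne hσ hN hNt hdiv
    filter_upwards [compl_mem_ae_iff.2 h0] with x hx
    rw [compl_compl] at hx
    obtain ⟨g, hg⟩ := mem_iUnion.1 hx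
    obtain ⟨n, hn⟩ := mem_iUnion.1 hg
    exact apply_mem_conicalLimitSet g (limsupShadow_subset hd (by positivity) hn).2
  -- One scale has positive mass, and by ergodicity its saturation has full mass. The uniform
  -- conical limit set contains this saturation because it is invariant.
  · obtain ⟨ε₀, hε₀, hpos⟩ := hcμ.exists_measure_limsupShadow_ne_zero
      (IsProbabilityMeasure.ne_zero μ) hd hne hσ hN hNt hdiv
    refine ⟨ε₀, hε₀, fun ε _ hle => ?_⟩
    filter_upwards [compl_mem_ae_iff.2 (herg.measure_compl_saturation
      (measurableSet_limsupShadow hd ε₀) hpos)] with x hx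
    rw [compl_compl] at hx
    obtain ⟨g, hg⟩ := mem_iUnion.1 hx
    exact uniformConicalLimitSet_anti hle
      (apply_mem_uniformConicalLimitSet g (limsupShadow_subset hd hε₀ hg).1)
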